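/- Let $\Delta_A,\Delta_B\ge 1$ be fixed integers. There exist a decoding algorithm (a program for a random access machine with uniform cost) and a constant $C$, both depending only on $\Delta_A$ and $\Delta_B$, such that the following holds. Let $G=(A\cup B,\mathcal E)$ be a finite bipartite graph with $|A|=n_A$, $|B|=n_B$ and $1\le n_B\le n_A$, in which every vertex of $A$ has degree $\Delta_A$ and every vertex of $B$ has degree $\Delta_B$. Let $\gamma_A,\gamma_B>0$ and $0<\delta_A,\delta_B<1/6$. Write $\Gamma(S)$ for the set of neighbours of a set of vertices $S$, and suppose that $|\Gamma(S)|\ge(1-\delta_A)\Delta_A|S|$ for every $S\subseteq A$ with $|S|\le\gamma_A n_A$, and $|\Gamma(S)|\ge(1-\delta_B)\Delta_B|S|$ for every $S\subseteq B$ with $|S|\le\gamma_B n_B$. Let $H\in\mathbb F_2^{n_B\times n_A}$ be the biadjacency matrix of $G$ (rows indexed by $B$, columns by $A$), and let $\mathcal Q_G$ be the CSS quantum code of length $n=n_A^2+n_B^2$, with qubits indexed by $A^2\cup B^2$, defined by the parity-check matrices $$H_X=\left(1_{n_A}\otimes H,\; H^T\otimes 1_{n_B}\right),\qquad H_Z=\left(H\otimes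 1_{n_A},\; 1_{n_B}\otimes H^T\right).$$ On input the graph $G$ (given by $n_A$, $n_B$ and $H$) and any pair of vectors $(s_X,s_Z)\in\mathbb F_2^{A\times B}\times\mathbb F_2^{B\times A}$, the algorithm halts after at most $C\,n$ elementary steps. Moreover, if $s_X=H_Xe_X^T$ and $s_Z=H_Ze_Z^T$ for an error pattern $(e_X,e_Z)\in\mathbb F_2^n\times\mathbb F_2^n$ whose weight, i.e. the number of coordinates in which at least one of $e_X,e_Z$ is non-zero, is less than $$w_0=\frac{1}{3(1+\Delta_B)}\min\left(\gamma_A n_A,\gamma_B n_B\right),$$ then the output of the algorithm is of the form $(e_X+f_X,\,e_Z+f_Z)$ with $f_X$ in the row space of $H_Z$ and $f_Z$ in the row space of $H_X$. -/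

import Mathlib

open scoped Kronecker

/-! ### Bipartite graphs, biregularity, expansion -/

/-- A (simple) bipartite graph with left vertex set `A = Fin nA` and right vertex set
`B = Fin nB`, given by its adjacency relation. -/
structure BipartiteGraph (nA nB : ℕ) where
  /-- `Adj a b` says that `a ∈ A` and `b ∈ B` are adjacent. -/
  Adj : Fin nA → Fin nB → Prop

namespace BipartiteGraph

variable {nA nB : ℕ} (G : BipartiteGraph nA nB)

open Classical in
/-- The set of neighbours in `B` of the vertices of `S ⊆ A`. -/
noncomputable def leftNeighbors (S : Finset (Fin nA)) : Finset (Fin nB) :=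
  Finset.univ.filter fun b => ∃ a ∈ S, G.Adj a b

open Classical in
/-- The set of neighbours in `A` of the vertices of `S ⊆ B`. -/
noncomputable def rightNeighbors (S : Finset (Fin nB)) : Finset (Fin nA) :=
  Finset.univ.filter fun a => ∃ b ∈ S, G.Adj a b

/-- Every left vertex has degree `ΔA` and every right vertex has degree `ΔB`. -/
def IsBiregular (ΔA ΔB : ℕ) : Prop :=
  (∀ a, (G.leftNeighbors {a}).card = ΔA) ∧ (∀ b, (G.rightNeighbors {b}).card = ΔB)

/-- `(γ, δ)`-left-expansion of a graph with left degree `ΔA`. -/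
def IsLeftExpanding (ΔA : ℕ) (γ δ : ℝ) : Prop :=
  ∀ S : Finset (Fin nA), (S.card : ℝ) ≤ γ * nA →
    (1 - δ) * ΔA * S.card ≤ ((G.leftNeighbors S).card : ℝ)

/-- `(γ, δ)`-right-expansion of a graph with right degree `ΔB`. -/
def IsRightExpanding (ΔB : ℕ) (γ δ : ℝ) : Prop :=
  ∀ S : Finset (Fin nB), (S.card : ℝ) ≤ γ * nB →
    (1 - δ) * ΔB * S.card ≤ ((G.rightNeighbors S).card : ℝ)

/-! ### The hypergraph-product quantum code -/

open Classical in
/-- The `nB × nA` biadjacency matrix of `G` over the field with two elements. -/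
noncomputable def H : Matrix (Fin nB) (Fin nA) (ZMod 2) :=
  Matrix.of fun b a => if G.Adj a b then 1 else 0

/-- `H_X = (1 ⊗ H, Hᵀ ⊗ 1)`, with rows indexed by `A × B` and columns by `A² ∪ B²`. -/
noncomputable def HX :
    Matrix (Fin nA × Fin nB) ((Fin nA × Fin nA) ⊕ (Fin nB × Fin nB)) (ZMod 2) :=
  Matrix.fromCols ((1 : Matrix (Fin nA) (Fin nA) (ZMod 2)) ⊗ₖ G.H)
    (G.H.transpose ⊗ₖ (1 : Matrix (Fin nB) (Fin nB) (ZMod 2)))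

/-- `H_Z = (H ⊗ 1, 1 ⊗ Hᵀ)`, with rows indexed by `B × A` and columns by `A² ∪ B²`. -/
noncomputable def HZ :
    Matrix (Fin nB × Fin nA) ((Fin nA × Fin nA) ⊕ (Fin nB × Fin nB)) (ZMod 2) :=
  Matrix.fromCols (G.H ⊗ₖ (1 : Matrix (Fin nA) (Fin nA) (ZMod 2)))
    ((1 : Matrix (Fin nB) (Fin nB) (ZMod 2)) ⊗ₖ G.H.transpose)

end BipartiteGraph

/-- The set of qubits `A² ∪ B²` of the hypergraph-product code. -/
abbrev Qubit (nA nB : ℕ) : Type := (Fin nA × Fin nA) ⊕ (Fin nB × Fin nB)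

/-- The row space of a matrix over the field with two elements. -/
def rowSpace {ρ κ : Type*} (M : Matrix ρ κ (ZMod 2)) : Submodule (ZMod 2) (κ → ZMod 2) :=
  Submodule.span (ZMod 2) (Set.range M.row)

/-- The weight of the error pattern `(eX, eZ)`: the number of qubits on which at least one of the
two vectors is non-zero. -/
def errorWeight {κ : Type*} [Fintype κ] (eX eZ : κ → ZMod 2) : ℕ :=
  (Finset.univ.filter fun q => eX q ≠ 0 ∨ eZ q ≠ 0).card

/-! ### Random access machine programs with uniform cost

A machine has integer registers and arrays of integer cells (a program, being finite, mentions
only finitely many of them), indirect addressing, addition and truncated subtraction. Every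
elementary operation takes one unit of time. -/

namespace RAM

/-- A memory configuration: the contents of the registers and of the arrays. -/
structure State where
  /-- `reg x` is the content of register `x`. -/
  reg : ℕ → ℕ
  /-- `arr a i` is the content of cell `i` of array `a`. -/
  arr : ℕ → ℕ → ℕ

/-- Overwrite register `x` by `v`. -/
def State.setReg (s : State) (x v : ℕ) : State :=
  { s with reg := Function.update s.reg x v }

/-- Overwrite cell `i` of array `a` by `v`. -/
def State.setArr (s : State) (a i v : ℕ) : State :=
  { s with arr := Function.update s.arr a (Function.update (s.arr a) i v) }

/-- Arithmetic expressions. -/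
inductive Expr : Type
  | lit (c : ℕ)
  | reg (x : ℕ)
  | get (a : ℕ) (i : Expr)
  | add (e f : Expr)
  | sub (e f : Expr)

/-- The value of an expression; `sub` is truncated subtraction. -/
def Expr.eval (s : State) : Expr → ℕ
  | lit c => c
  | reg x => s.reg x
  | get a i => s.arr a (i.eval s)
  | add e f => e.eval s + f.eval s
  | sub e f => e.eval s - f.eval s

/-- The time needed to evaluate an expression: one unit for each operation in it. -/
def Expr.cost : Expr → ℕ
  | lit _ => 1
  | reg _ => 1
  | get _ i => i.cost + 1
  | add e f => e.cost + f.cost + 1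
  | sub e f => e.cost + f.cost + 1

/-- Programs. -/
inductive Program : Type
  | skip
  /-- `x := e` -/
  | assign (x : ℕ) (e : Expr)
  /-- `a[i] := e` -/
  | put (a : ℕ) (i e : Expr)
  | seq (p q : Program)
  /-- if `e ≠ 0` then `p` else `q` -/
  | cond (e : Expr) (p q : Program)
  /-- while `e ≠ 0` do `p` -/
  | loop (e : Expr) (p : Program)

/-- `Exec p s t s'`: the program `p`, started in state `s`, halts after exactly `t` units of time
in state `s'`. -/
inductive Exec : Program → State → ℕ → State → Prop
  | skip (s : State) : Exec .skip s 1 s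
  | assign (x : ℕ) (e : Expr) (s : State) :
      Exec (.assign x e) s (e.cost + 1) (s.setReg x (e.eval s))
  | put (a : ℕ) (i e : Expr) (s : State) :
      Exec (.put a i e) s (i.cost + e.cost + 1) (s.setArr a (i.eval s) (e.eval s))
  | seq {p q : Program} {s s₁ s₂ : State} {t₁ t₂ : ℕ} :
      Exec p s t₁ s₁ → Exec q s₁ t₂ s₂ → Exec (.seq p q) s (t₁ + t₂) s₂
  | cond_true {e : Expr} {p q : Program} {s s₁ : State} {t : ℕ} :
      e.eval s ≠ 0 → Exec p s t s₁ → Exec (.cond e p q) s (e.cost + 1 + t) s₁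
  | cond_false {e : Expr} {p q : Program} {s s₁ : State} {t : ℕ} :
      e.eval s = 0 → Exec q s t s₁ → Exec (.cond e p q) s (e.cost + 1 + t) s₁
  | loop_true {e : Expr} {p : Program} {s s₁ s₂ : State} {t₁ t₂ : ℕ} :
      e.eval s ≠ 0 → Exec p s t₁ s₁ → Exec (.loop e p) s₁ t₂ s₂ →
      Exec (.loop e p) s (e.cost + 1 + t₁ + t₂) s₂
  | loop_false {e : Expr} {p : Program} {s : State} :
      e.eval s = 0 → Exec (.loop e p) s (e.cost + 1) s

end RAM

/-! ### Input and output of a decoder -/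

/-- The array that stores a binary `m × n` table row by row: the entry `(i, j)` is stored as `0`
or `1` in cell `i * n + j`, and all further cells contain `0`. -/
def bitArray {m n : ℕ} (v : Fin m × Fin n → ZMod 2) : ℕ → ℕ :=
  fun i => if h : i < m * n then (v (finProdFinEquiv.symm ⟨i, h⟩)).val else 0

/-- The initial state of a decoder that is given the graph `G` and the pair of syndromes
`(sX, sZ)`: registers `0` and `1` contain `nA` and `nB`, arrays `0`, `1`, `2` contain the matrix
`H` and the two syndromes, and everything else is `0`. -/
noncomputable def decoderInput {nA nB : ℕ} (G : BipartiteGraph nA nB)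
    (sX : Fin nA × Fin nB → ZMod 2) (sZ : Fin nB × Fin nA → ZMod 2) : RAM.State where
  reg := fun
    | 0 => nA
    | 1 => nB
    | _ => 0
  arr := fun
    | 0 => bitArray fun p => G.H p.1 p.2
    | 1 => bitArray sX
    | 2 => bitArray sZ
    | _ => fun _ => 0

/-- In the state `s`, the arrays `3` and `4` hold the `A²` part and the `B²` part of the binary
vector `oX`, and the arrays `5` and `6` hold those of `oZ`, each stored row by row. -/
def DecoderOutputs {nA nB : ℕ} (s : RAM.State) (oX oZ : Qubit nA nB → ZMod 2) : Prop :=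
  (∀ i j : Fin nA, s.arr 3 (i * nA + j) = (oX (Sum.inl (i, j))).val) ∧
  (∀ i j : Fin nB, s.arr 4 (i * nB + j) = (oX (Sum.inr (i, j))).val) ∧
  (∀ i j : Fin nA, s.arr 5 (i * nA + j) = (oZ (Sum.inl (i, j))).val) ∧
  (∀ i j : Fin nB, s.arr 6 (i * nB + j) = (oZ (Sum.inr (i, j))).val)

/-- The output found in the state `s` is a correct decoding of the error pattern `(eX, eZ)`: it is
of the form `(eX + fX, eZ + fZ)` with `fX` in the row space of `H_Z` and `fZ` in the row space of
`H_X`. -/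
def CorrectlyDecodes {nA nB : ℕ} (G : BipartiteGraph nA nB) (s : RAM.State)
    (eX eZ : Qubit nA nB → ZMod 2) : Prop :=
  ∃ fX ∈ rowSpace G.HZ, ∃ fZ ∈ rowSpace G.HX, DecoderOutputs s (eX + fX) (eZ + fZ)

/-! ### Hamming weights of binary vectors -/

section HammingWeight

variable {ι : Type*} [Fintype ι]

/-- The change of weight of a binary vector at a coordinate with value `u` when `v` is added. -/
def flipGain (u v : ZMod 2) : ℤ := if v = 0 then 0 else if u = 0 then 1 else -1

theorem hammingNorm_eq_sum (s : ι → ZMod 2) :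
    hammingNorm s = ∑ p, if s p = 0 then 0 else 1 := by
  simp only [hammingNorm, Finset.card_filter, ne_eq, ite_not]

theorem hammingNorm_add_eq (s D : ι → ZMod 2) :
    (hammingNorm (s + D) : ℤ) = hammingNorm s + ∑ p, flipGain (s p) (D p) := by
  rw [hammingNorm_eq_sum, hammingNorm_eq_sum]
  push_cast
  rw [← Finset.sum_add_distrib]
  refine Finset.sum_congr rfl fun p _ => ?_
  have key : ∀ u v : ZMod 2,
      (if u + v = 0 then (0 : ℤ) else 1) = (if u = 0 then 0 else 1) + flipGain u v := by
    decide
  simpa using key (s p) (D p)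

theorem hammingNorm_add_le (s D : ι → ZMod 2) :
    hammingNorm (s + D) ≤ hammingNorm s + hammingNorm D := by
  rw [hammingNorm_eq_sum, hammingNorm_eq_sum, hammingNorm_eq_sum, ← Finset.sum_add_distrib]
  refine Finset.sum_le_sum fun p _ => ?_
  have key : ∀ u v : ZMod 2, (if u + v = 0 then (0 : ℕ) else 1) ≤
      (if u = 0 then 0 else 1) + (if v = 0 then 0 else 1) := by
    decide
  simpa using key (s p) (D p)

theorem hammingNorm_sum_le {κ : Type*} (S : Finset κ) (f : κ → ι → ZMod 2) :
    hammingNorm (∑ k ∈ S, f k) ≤ ∑ k ∈ S, hammingNorm (f k) := by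
  classical
  induction S using Finset.induction_on with
  | empty => simp
  | insert k S hk ih =>
    rw [Finset.sum_insert hk, Finset.sum_insert hk]
    exact (hammingNorm_add_le _ _).trans (by gcongr)

theorem hammingNorm_single_one [DecidableEq ι] (i : ι) :
    hammingNorm (Pi.single i 1 : ι → ZMod 2) = 1 := by
  rw [hammingNorm_eq_sum, Finset.sum_eq_single i] <;> simp +contextual

theorem hammingNorm_add_single [DecidableEq ι] (s : ι → ZMod 2) (i : ι) :
    (hammingNorm (s + Pi.single i 1) : ℤ) = hammingNorm s + 1 - 2 * (s i).val := by
  rw [hammingNorm_add_eq, Finset.sum_eq_single i]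
  · have key : ∀ u : ZMod 2, flipGain u 1 = 1 - 2 * u.val := by decide
    rw [Pi.single_eq_same, key]; ring
  · intro j _ hj; simp [Pi.single_eq_of_ne hj, flipGain]
  · simp

theorem hammingNorm_add_indicator (e g : ι → ZMod 2) (S : Finset ι) (h₁ : ∀ q ∈ S, g q = 1)
    (h₀ : ∀ q ∉ S, g q = 0) :
    hammingNorm (e + g) + 2 * (S.filter fun q => e q ≠ 0).card
      = hammingNorm e + S.card := by
  classical
  have h1 : (S.filter fun q => e q ≠ 0).card = ∑ q, if q ∈ S ∧ e q ≠ 0 then 1 else 0 := by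
    rw [← Finset.card_filter, ← Finset.filter_filter]; simp
  have h2 : S.card = ∑ q, if q ∈ S then 1 else 0 := by
    rw [← Finset.card_filter]; simp
  rw [hammingNorm_eq_sum, hammingNorm_eq_sum, h1, h2, Finset.mul_sum, ← Finset.sum_add_distrib,
    ← Finset.sum_add_distrib]
  refine Finset.sum_congr rfl fun q _ => ?_
  have key : ∀ u : ZMod 2, (if u + 1 = 0 then 0 else 1) + 2 * (if u ≠ 0 then 1 else 0)
      = (if u = 0 then 0 else 1) + 1 := by decide
  by_cases hq : q ∈ S
  · simpa [hq, h₁] using key (e q)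
  · simp [hq, h₀]

/-- A binary vector is the sum of the unit vectors in its support. -/
theorem eq_sum_single [DecidableEq ι] (e : ι → ZMod 2) :
    e = ∑ q ∈ Finset.univ.filter (fun q => e q ≠ 0), Pi.single q (1 : ZMod 2) := by
  funext p
  rw [Finset.sum_apply]
  have h2 : ∀ u : ZMod 2, u ≠ 0 → u = 1 := by decide
  by_cases hp : e p = 0
  · rw [hp, Finset.sum_eq_zero]
    intro q hq
    rw [Pi.single_eq_of_ne]
    rintro rfl
    simp_all
  · rw [Finset.sum_eq_single p] <;> simp +contextual [hp, h2, eq_comm]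

end HammingWeight

/-! ### Unique neighbours -/

/-- In a set of vertices that expands by a factor greater than `5/6` of the degree, some vertex
has more than two thirds of its neighbours to itself. -/
theorem exists_card_shared_lt {ι κ : Type*} [DecidableEq ι] [DecidableEq κ] (N : ι → Finset κ)
    (D : ℕ) (δ : ℝ) (hD : 0 < D) (hδ : δ < 1 / 6) (hN : ∀ i, (N i).card = D) (S : Finset ι)
    (hS : S.Nonempty) (hexp : (1 - δ) * D * S.card ≤ ((S.biUnion N).card : ℝ)) :
    ∃ i ∈ S, 3 * ((N i).filter fun k => ∃ i' ∈ S, i' ≠ i ∧ k ∈ N i').card < D := by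
  by_contra! hcon
  set m : ι → ℕ := fun i => ((N i).filter fun k => ∃ i' ∈ S, i' ≠ i ∧ k ∈ N i').card with hm
  set u : ι → ℕ := fun i => ((N i).filter fun k => ¬ ∃ i' ∈ S, i' ≠ i ∧ k ∈ N i').card with hu
  have hmu : ∀ i, m i + u i = D := fun i => by
    rw [← hN i]; exact Finset.card_filter_add_card_filter_not _
  -- Incidences with unshared neighbours count twice, all others once. Every neighbour then receives
  -- at least 2: from its only owner, or from two different ones.
  have hcount : 2 * (S.biUnion N).card ≤ ∑ i ∈ S, (D + u i) := by
    have h1 : ∑ i ∈ S, (D + u i) = ∑ k ∈ S.biUnion N, ∑ i ∈ S, (if k ∈ N i then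
        1 + (if ∃ i' ∈ S, i' ≠ i ∧ k ∈ N i' then 0 else 1) else 0) := by
      rw [Finset.sum_comm]
      refine Finset.sum_congr rfl fun i hi => ?_
      rw [← Finset.sum_filter]
      have h2 : (S.biUnion N).filter (fun k => k ∈ N i) = N i := by
        ext k; simp only [Finset.mem_filter, Finset.mem_biUnion]
        exact ⟨fun h => h.2, fun h => ⟨⟨i, hi, h⟩, h⟩⟩
      rw [h2, Finset.sum_add_distrib, ← Finset.card_eq_sum_ones, hN, hu]
      simp only [Finset.card_filter, ite_not]
    rw [h1, mul_comm, ← smul_eq_mul]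
    refine Finset.card_nsmul_le_sum _ _ _ fun k hk => ?_
    obtain ⟨i, hi, hki⟩ := Finset.mem_biUnion.1 hk
    by_cases hsh : ∃ i' ∈ S, i' ≠ i ∧ k ∈ N i'
    · obtain ⟨i', hi', hne, hki'⟩ := hsh
      calc 2 = ∑ j ∈ ({i, i'} : Finset ι), 1 := by simp [Finset.card_pair hne.symm]
        _ ≤ ∑ j ∈ ({i, i'} : Finset ι), (if k ∈ N j then
        1 + (if ∃ i' ∈ S, i' ≠ j ∧ k ∈ N i' then 0 else 1) else 0) := by
            refine Finset.sum_le_sum fun j hj => ?_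
            have : k ∈ N j := by
              rcases Finset.mem_insert.1 hj with rfl | hj
              · exact hki
              · rw [Finset.mem_singleton.1 hj]; exact hki'
            rw [if_pos this]; omega
        _ ≤ _ := by
            refine Finset.sum_le_sum_of_subset ?_
            intro j hj
            rcases Finset.mem_insert.1 hj with rfl | hj
            · exact hi
            · rw [Finset.mem_singleton.1 hj]; exact hi'
    · calc 2 = (if k ∈ N i then
        1 + (if ∃ i' ∈ S, i' ≠ i ∧ k ∈ N i' then 0 else 1) else 0) := by
              rw [if_pos hki, if_neg hsh]
        _ ≤ _ := Finset.single_le_sum (f := fun i => if k ∈ N i then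
        1 + (if ∃ i' ∈ S, i' ≠ i ∧ k ∈ N i' then 0 else 1) else 0) (fun _ _ => Nat.zero_le _) hi
  -- If every vertex shares a third of its neighbours, then `D + u i ≤ 5D/3`, so the neighbourhood
  -- has at most `(5/6) D |S|` elements. This is the origin of the bound 1/6 on `δ`.
  have hle : 3 * ∑ i ∈ S, (D + u i) ≤ 5 * (D * S.card) := by
    rw [Finset.mul_sum, show 5 * (D * S.card) = ∑ i ∈ S, 5 * D by simp; ring]
    refine Finset.sum_le_sum fun i hi => ?_
    have := hcon i hi
    have := hmu i
    simp only [hm] at *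
    omega
  have h6 : (6 * (S.biUnion N).card : ℝ) ≤ 5 * (D * S.card) := by
    exact_mod_cast (by omega : 6 * (S.biUnion N).card ≤ 5 * (D * S.card))
  have hpos : (0 : ℝ) < D * S.card := by
    have := Finset.card_pos.2 hS
    positivity
  nlinarith

/-! ### Flipping rows and columns of a grid -/

theorem sum_indicator_mul {α β : Type*} [Fintype α] [Fintype β] [DecidableEq α] [DecidableEq β]
    (S : Finset α) (T : Finset β) (c : ℤ) :
    ∑ p : α × β, (if p.1 ∈ S ∧ p.2 ∈ T then c else 0) = c * (S.card * T.card) := by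
  have : (Finset.univ.filter fun p : α × β => p.1 ∈ S ∧ p.2 ∈ T) = S ×ˢ T := by
    ext p; simp
  rw [← Finset.sum_filter, this, Finset.sum_const, Finset.card_product]
  simp [mul_comm]

/-- A check is toggled exactly when one of its row and column is flipped but not both. On the four
blocks the syndrome is known: 0 on `x₁ × y₁` and `x₂ × y₂`, 1 on the mixed blocks; this gives the
first four terms exactly. The last two charge the worst case for toggled checks in one uncontrolled
row or column. Checks with both uncontrolled are never toggled. -/
theorem hammingNorm_add_grid_le {α β : Type*} [Fintype α] [Fintype β] [DecidableEq α]
    [DecidableEq β] (s : α × β → ZMod 2) (R x₁ x₂ x : Finset α) (C y₁ y₂ y : Finset β)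
    (i₁ i₂ j₁ j₂ : Bool) (hx : Disjoint x₁ x₂) (hy : Disjoint y₁ y₂)
    (hxs : x ⊆ x₁ ∪ x₂) (hys : y ⊆ y₁ ∪ y₂) (hR : x₁ ∪ x₂ ⊆ R) (hC : y₁ ∪ y₂ ⊆ C)
    (hx₁ : ∀ a ∈ x₁, (a ∈ x ↔ i₁ = true)) (hx₂ : ∀ a ∈ x₂, (a ∈ x ↔ i₂ = true))
    (hy₁ : ∀ b ∈ y₁, (b ∈ y ↔ j₁ = true)) (hy₂ : ∀ b ∈ y₂, (b ∈ y ↔ j₂ = true))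
    (hs : ∀ a ∈ x₁ ∪ x₂, ∀ b ∈ y₁ ∪ y₂,
      s (a, b) = (if a ∈ x₁ then 1 else 0) + (if b ∈ y₁ then 1 else 0)) :
    (hammingNorm (s + fun p => (if p.1 ∈ x ∧ p.2 ∈ C then 1 else 0) +
        (if p.2 ∈ y ∧ p.1 ∈ R then 1 else 0)) : ℤ) ≤ hammingNorm s +
      ((if i₁ = j₁ then 0 else 1) * (x₁.card * y₁.card)
        + (if i₁ = j₂ then 0 else -1) * (x₁.card * y₂.card)
        + (if i₂ = j₁ then 0 else -1) * (x₂.card * y₁.card)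
        + (if i₂ = j₂ then 0 else 1) * (x₂.card * y₂.card)
        + 1 * (x.card * (C \ (y₁ ∪ y₂)).card) + 1 * ((R \ (x₁ ∪ x₂)).card * y.card)) := by
  rw [hammingNorm_add_eq]
  simp only [← sum_indicator_mul, ← Finset.sum_add_distrib]
  refine add_le_add le_rfl (Finset.sum_le_sum fun ⟨a, b⟩ _ => ?_)
  have hs' := hs a
  have hx₁' := hx₁ a
  have hx₂' := hx₂ a
  have hy₁' := hy₁ b
  have hy₂' := hy₂ b
  have hxs' := @hxs a
  have hys' := @hys b
  have hR' := @hR a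
  have hC' := @hC b
  have hxd : a ∈ x₁ → a ∉ x₂ := fun h => Finset.disjoint_left.1 hx h
  have hyd : b ∈ y₁ → b ∉ y₂ := fun h => Finset.disjoint_left.1 hy h
  have hs'' := fun h => hs' h b
  clear hs' hs hx₁ hx₂ hy₁ hy₂ hxs hys hR hC hx hy
  simp only [Finset.mem_union, Finset.mem_sdiff] at *
  generalize s (a, b) = u at *
  have h11 : (1 : ZMod 2) + 1 = 0 := by decide
  by_cases ha₁ : a ∈ x₁ <;> by_cases ha₂ : a ∈ x₂ <;> by_cases hb₁ : b ∈ y₁ <;>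
    by_cases hb₂ : b ∈ y₂ <;> by_cases ha : a ∈ x <;> by_cases hb : b ∈ y <;>
    simp [ha₁, ha₂, hb₁, hb₂, ha, hb] at * <;>
    simp [*, flipGain]
  all_goals split_ifs <;> simp

/-- Here `p₁`, `p₂` count the controlled rows with and without an error, `c` the uncontrolled rows;
`q₁`, `q₂`, `d` do the same for columns. If the two kinds of rows or of columns are unbalanced, a
single block is a good flip. Otherwise flipping either all erroneous or all error-free controlled
qubits works: the former removes the error, the latter does so up to the generator. -/
theorem exists_block_flip (p₁ p₂ q₁ q₂ c d : ℤ) (hp₁ : 0 ≤ p₁) (hp₂ : 0 ≤ p₂) (hq₁ : 0 ≤ q₁)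
    (hq₂ : 0 ≤ q₂) (hc : 0 ≤ c) (hd : 0 ≤ d) (hP : 2 * c + 1 ≤ p₁ + p₂)
    (hQ : 2 * d + 1 ≤ q₁ + q₂) (hne : 1 ≤ p₁ + q₁)
    (hred : 2 * (p₁ + q₁) ≤ (p₁ + p₂ + c) + (q₁ + q₂ + d)) :
    ∃ i₁ i₂ j₁ j₂ : Bool,
      1 ≤ ((if i₁ then p₁ else 0) + (if i₂ then p₂ else 0)) +
          ((if j₁ then q₁ else 0) + (if j₂ then q₂ else 0)) ∧
      3 * ((if i₁ = j₁ then 0 else 1) * (p₁ * q₁) + (if i₁ = j₂ then 0 else -1) * (p₁ * q₂)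
        + (if i₂ = j₁ then 0 else -1) * (p₂ * q₁) + (if i₂ = j₂ then 0 else 1) * (p₂ * q₂)
        + 1 * (((if i₁ then p₁ else 0) + (if i₂ then p₂ else 0)) * d)
        + 1 * (c * ((if j₁ then q₁ else 0) + (if j₂ then q₂ else 0))))
      -- The number of flipped qubits: three times the change of weight must outweigh it.
      + (((if i₁ then p₁ else 0) + (if i₂ then p₂ else 0)) +
          ((if j₁ then q₁ else 0) + (if j₂ then q₂ else 0))) ≤ 0 := by
  by_cases h1 : 1 ≤ p₁ ∧ q₁ + d + 1 ≤ q₂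
  · refine ⟨true, false, false, false, by simpa using h1.1, ?_⟩
    simp
    nlinarith [h1.1, h1.2]
  by_cases h2 : 1 ≤ p₂ ∧ q₂ + d + 1 ≤ q₁
  · refine ⟨false, true, false, false, by simpa using h2.1, ?_⟩
    simp
    nlinarith [h2.1, h2.2]
  by_cases h3 : 1 ≤ q₁ ∧ p₁ + c + 1 ≤ p₂
  · refine ⟨false, false, true, false, by simpa using h3.1, ?_⟩
    simp
    nlinarith [h3.1, h3.2]
  by_cases h4 : 1 ≤ q₂ ∧ p₂ + c + 1 ≤ p₁
  · refine ⟨false, false, false, true, by simpa using h4.1, ?_⟩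
    simp
    nlinarith [h4.1, h4.2]
  -- An empty block would allow one of the single-block flips above, or would force more than half
  -- of the qubits to be in error, against `hred`.
  have hp₁' : 1 ≤ p₁ := by omega
  have hq₁' : 1 ≤ q₁ := by omega
  have hp₂' : 1 ≤ p₂ := by omega
  have hq₂' : 1 ≤ q₂ := by omega
  have a1 : q₂ ≤ q₁ + d := by omega
  have a2 : q₁ ≤ q₂ + d := by omega
  have a3 : p₂ ≤ p₁ + c := by omega
  have a4 : p₁ ≤ p₂ + c := by omega
  obtain ⟨P, rfl⟩ : ∃ P, p₂ = P - p₁ := ⟨p₁ + p₂, by ring⟩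
  obtain ⟨Q, rfl⟩ : ∃ Q, q₂ = Q - q₁ := ⟨q₁ + q₂, by ring⟩
  -- the deviations `u`, `v` of the error from one half
  set u := 2 * p₁ - P with hu
  set v := 2 * q₁ - Q with hv
  -- For `c' = c - u`, `d' = d - v` the left side is twice the size of the error-free flip, and the
  -- bracket on the right is twice its guaranteed gain. With `c + u`, `d + v` the same holds for the
  -- erroneous flip. In the extreme case `P - c = c + 1`, `Q - d = d + 1` the inequality reads `3c +
  -- 3d + 2 ≤ 3c + 3d + 3`.
  have key : ∀ c' d' : ℤ, 0 ≤ c' → 0 ≤ d' → c' ≤ 2 * c → d' ≤ 2 * d → c' * d' ≤ c * d →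
      (P - c + c') + (Q - d + d') ≤ 3 * ((P - c) * (Q - d) - c' * d') := by
    intro c' d' hc' hd' hc2 hd2 hcd
    have hR : c + 1 ≤ P - c := by omega
    have hS : d + 1 ≤ Q - d := by omega
    nlinarith [mul_nonneg (sub_nonneg.2 hR) (sub_nonneg.2 hS), mul_nonneg hc (sub_nonneg.2 hS),
      mul_nonneg hd (sub_nonneg.2 hR)]
  by_cases hcd : (c - u) * (d - v) ≤ c * d
  · refine ⟨false, true, false, true, by simp; omega, ?_⟩
    have := key (c - u) (d - v) (by omega) (by omega) (by omega) (by omega) hcd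
    simp
    nlinarith
  -- The product of the two quantities is `(c² - u²)(d² - v²) ≤ c²d²`, so both cannot exceed `cd`.
  · have hcd' : (c + u) * (d + v) ≤ c * d := by
      by_contra! h
      push Not at hcd
      have hcu : 0 ≤ c - u := by omega
      have hcu' : 0 ≤ c + u := by omega
      have hdv : 0 ≤ d - v := by omega
      have hdv' : 0 ≤ d + v := by omega
      have e1 : (c - u) * (c + u) ≤ c * c := by nlinarith [sq_nonneg u]
      have e2 : (d - v) * (d + v) ≤ d * d := by nlinarith [sq_nonneg v]
      have e3 := mul_le_mul e1 e2 (mul_nonneg hdv hdv') (mul_nonneg hc hc)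
      have e4 := mul_lt_mul'' hcd h (mul_nonneg hc hd) (mul_nonneg hc hd)
      nlinarith
    refine ⟨true, false, true, false, by simp; omega, ?_⟩
    have := key (c + u) (d + v) (by omega) (by omega) (by omega) (by omega) hcd'
    simp
    nlinarith

/-! ### Syndromes and generators in coordinates -/

namespace BipartiteGraph

variable {nA nB : ℕ} (G : BipartiteGraph nA nB)

/-- The neighbours of a left vertex. -/
noncomputable def nl (a : Fin nA) : Finset (Fin nB) := G.leftNeighbors {a}

/-- The neighbours of a right vertex. -/
noncomputable def nr (b : Fin nB) : Finset (Fin nA) := G.rightNeighbors {b}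

variable {G} in
theorem mem_nl {a : Fin nA} {b : Fin nB} : b ∈ G.nl a ↔ G.Adj a b := by
  simp [nl, leftNeighbors]

variable {G} in
theorem mem_nr {a : Fin nA} {b : Fin nB} : a ∈ G.nr b ↔ G.Adj a b := by
  simp [nr, rightNeighbors]

theorem leftNeighbors_eq_biUnion (S : Finset (Fin nA)) :
    G.leftNeighbors S = S.biUnion G.nl := by
  ext b; simp [leftNeighbors, mem_nl]

theorem rightNeighbors_eq_biUnion (S : Finset (Fin nB)) :
    G.rightNeighbors S = S.biUnion G.nr := by
  ext b; simp [rightNeighbors, mem_nr]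

theorem H_apply (a : Fin nA) (b : Fin nB) : G.H b a = if b ∈ G.nl a then 1 else 0 := by
  classical simp [H, mem_nl]

theorem HX_mulVec (e : Qubit nA nB → ZMod 2) (a : Fin nA) (b : Fin nB) :
    G.HX.mulVec e (a, b) =
      ∑ a' ∈ G.nr b, e (.inl (a, a')) + ∑ b' ∈ G.nl a, e (.inr (b', b)) := by
  simp only [HX, Matrix.mulVec, dotProduct, Fintype.sum_sum_type, Matrix.fromCols_apply_inl,
    Matrix.fromCols_apply_inr, Matrix.kroneckerMap_apply, Fintype.sum_prod_type,
    Matrix.one_apply, Matrix.transpose_apply, H_apply]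
  congr 1
  · rw [Finset.sum_eq_single a]
    · simp [mem_nl, ← mem_nr]
    · intro a' _ h; simp [h.symm]
    · simp
  · rw [Finset.sum_comm, Finset.sum_eq_single b]
    · simp
    · intro a' _ h; simp [h.symm]
    · simp

theorem HZ_mulVec (e : Qubit nA nB → ZMod 2) (a : Fin nA) (b : Fin nB) :
    G.HZ.mulVec e (b, a) =
      ∑ a' ∈ G.nr b, e (.inl (a', a)) + ∑ b' ∈ G.nl a, e (.inr (b, b')) := by
  simp only [HZ, Matrix.mulVec, dotProduct, Fintype.sum_sum_type, Matrix.fromCols_apply_inl,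
    Matrix.fromCols_apply_inr, Matrix.kroneckerMap_apply, Fintype.sum_prod_type,
    Matrix.one_apply, Matrix.transpose_apply, H_apply]
  congr 1
  · rw [Finset.sum_comm, Finset.sum_eq_single a]
    · simp [mem_nl, ← mem_nr]
    · intro a' _ h; simp [h.symm]
    · simp
  · rw [Finset.sum_eq_single b]
    · simp
    · intro a' _ h; simp [h.symm]
    · simp

/-- The indicator vector of the qubits `x × {α} ∪ {β} × y`. -/
def flipVec (β : Fin nB) (α : Fin nA) (x : Finset (Fin nA)) (y : Finset (Fin nB)) :
    Qubit nA nB → ZMod 2 :=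
  Sum.elim (fun p => if p.1 ∈ x ∧ p.2 = α then 1 else 0)
    (fun p => if p.2 ∈ y ∧ p.1 = β then 1 else 0)

theorem HX_mulVec_flipVec (β : Fin nB) (α : Fin nA) (x : Finset (Fin nA)) (y : Finset (Fin nB)) :
    G.HX.mulVec (flipVec β α x y) = fun p => (if p.1 ∈ x ∧ p.2 ∈ G.nl α then 1 else 0) +
      (if p.2 ∈ y ∧ p.1 ∈ G.nr β then 1 else 0) := by
  classical
  funext ⟨a, b⟩
  rw [HX_mulVec]
  by_cases h1 : a ∈ x <;> by_cases h2 : b ∈ y <;> simp [flipVec, h1, h2, mem_nl, mem_nr]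

theorem HZ_row (β : Fin nB) (α : Fin nA) :
    G.HZ.row (β, α) = flipVec β α (G.nr β) (G.nl α) := by
  classical
  funext q
  rcases q with ⟨a, a'⟩ | ⟨b, b'⟩
  · simp [HZ, flipVec, H_apply, mem_nl, mem_nr, Matrix.one_apply, eq_comm, ite_and]
    split_ifs <;> rfl
  · simp [HZ, flipVec, H_apply, mem_nl, Matrix.one_apply, eq_comm, ite_and]

/-- A full generator toggles each check of its grid twice, once through its row and once through its
column. -/
theorem HX_mulVec_of_mem_rowSpace {f : Qubit nA nB → ZMod 2} (hf : f ∈ rowSpace G.HZ) :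
    G.HX.mulVec f = 0 := by
  have : rowSpace G.HZ ≤ LinearMap.ker G.HX.mulVecLin := by
    refine Submodule.span_le.2 ?_
    rintro _ ⟨⟨β, α⟩, rfl⟩
    rw [SetLike.mem_coe, LinearMap.mem_ker, Matrix.mulVecLin_apply, HZ_row, HX_mulVec_flipVec]
    funext ⟨a, b⟩
    have h11 : (1 : ZMod 2) + 1 = 0 := by decide
    by_cases h : a ∈ G.nr β ∧ b ∈ G.nl α
    · simp [h, h11]
    · simp only [if_neg h, if_neg (fun h' => h (And.symm h')), add_zero, Pi.zero_apply]
  exact this hf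

end BipartiteGraph

/-! ### Critical generators -/

namespace BipartiteGraph

variable {nA nB : ℕ} (G : BipartiteGraph nA nB)

-- Counting edges from both sides gives `nA * ΔA = nB * ΔB`. As a consequence `ΔB` alone bounds the
-- number of checks on a qubit of either kind.
variable {G} in
theorem IsBiregular.degree_le {ΔA ΔB : ℕ} (hG : G.IsBiregular ΔA ΔB) (hA : 0 < nA)
    (h : nB ≤ nA) : ΔA ≤ ΔB := by
  classical
  have h1 : ∑ a, (G.nl a).card = ∑ b, (G.nr b).card := by
    simp only [Finset.card_eq_sum_ones, Finset.sum_sigma']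
    refine Finset.sum_bij' (fun p _ => ⟨p.2, p.1⟩) (fun p _ => ⟨p.2, p.1⟩) ?_ ?_ ?_ ?_ ?_ <;>
      simp [mem_nl, mem_nr]
  have h2 : nA * ΔA = nB * ΔB := by
    rw [Finset.sum_congr rfl fun a _ => show (G.nl a).card = ΔA from hG.1 a,
      Finset.sum_congr rfl fun b _ => show (G.nr b).card = ΔB from hG.2 b] at h1
    simpa using h1
  by_contra! h3
  nlinarith

theorem HX_mulVec_single_inl (a α : Fin nA) :
    G.HX.mulVec (Pi.single (.inl (a, α)) 1) = ∑ b ∈ G.nl α, Pi.single (a, b) 1 := by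
  classical
  funext ⟨a', b⟩
  rw [HX_mulVec, Finset.sum_apply]
  by_cases h : a' = a
  · subst h
    simp [Pi.single_apply, mem_nl, mem_nr]
  · simp [h]

theorem HX_mulVec_single_inr (β b : Fin nB) :
    G.HX.mulVec (Pi.single (.inr (β, b)) 1) = ∑ a ∈ G.nr β, Pi.single (a, b) 1 := by
  classical
  funext ⟨a', b'⟩
  rw [HX_mulVec, Finset.sum_apply]
  by_cases h : b' = b
  · subst h
    simp [Pi.single_apply, mem_nl, mem_nr]
  · simp [h]

variable {G} in
theorem hammingNorm_HX_mulVec_le {ΔA ΔB : ℕ} (hG : G.IsBiregular ΔA ΔB) (hA : 0 < nA)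
    (h : nB ≤ nA) (e : Qubit nA nB → ZMod 2) :
    hammingNorm (G.HX.mulVec e) ≤ ΔB * hammingNorm e := by
  conv_lhs => rw [eq_sum_single e, ← Matrix.mulVecLin_apply, map_sum]
  refine (hammingNorm_sum_le _ _).trans ?_
  rw [mul_comm]
  refine Finset.sum_le_card_nsmul _ _ _ fun q _ => ?_
  rw [Matrix.mulVecLin_apply]
  rcases q with ⟨a, α⟩ | ⟨β, b⟩
  · rw [HX_mulVec_single_inl]
    refine (hammingNorm_sum_le _ _).trans ?_
    simp only [hammingNorm_single_one]
    simpa [nl] using (hG.1 α).le.trans (hG.degree_le hA h)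
  · rw [HX_mulVec_single_inr]
    refine (hammingNorm_sum_le _ _).trans ?_
    simp only [hammingNorm_single_one]
    simpa [nr] using (hG.2 β).le

/-- Expansion is applied to sets of row or column labels of erroneous qubits; such a set is no
larger than the error itself. -/
theorem card_image_le_hammingNorm {ι κ σ : Type*} [Fintype κ] [DecidableEq κ] [Fintype ι]
    [DecidableEq σ] (e : ι → ZMod 2) (f : κ → ι) (hf : Function.Injective f) (g : κ → σ)
    (p : κ → Prop) [DecidablePred p] (hp : ∀ k, p k → e (f k) ≠ 0) :
    ((Finset.univ.filter p).image g).card ≤ hammingNorm e := by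
  refine Finset.card_image_le.trans (Finset.card_le_card_of_injOn f ?_ hf.injOn)
  intro k hk
  simpa using hp k (by simpa using hk)

theorem sdiff_filter_not_eq {κ : Type*} [DecidableEq κ] (N : Finset κ) (p : κ → Prop)
    [DecidablePred p] [DecidablePred fun k => ¬ p k] :
    N \ N.filter (fun k => ¬ p k) = N.filter p := by
  ext k; simp only [Finset.mem_sdiff, Finset.mem_filter]; tauto

/-- A generator of the code around a small error that sees the error almost as if it were alone. -/
theorem exists_critical {ΔA ΔB : ℕ} (hΔA : 0 < ΔA) (hΔB : 0 < ΔB) (hG : G.IsBiregular ΔA ΔB)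
    {γA δA γB δB : ℝ} (hlA : G.IsLeftExpanding ΔA γA δA) (hrB : G.IsRightExpanding ΔB γB δB)
    (hδA : δA < 1 / 6) (hδB : δB < 1 / 6) (E : Qubit nA nB → ZMod 2) (hE : E ≠ 0)
    (hA : (hammingNorm E : ℝ) ≤ γA * nA) (hB : (hammingNorm E : ℝ) ≤ γB * nB) :
    ∃ (β : Fin nB) (α : Fin nA) (R : Finset (Fin nA)) (C : Finset (Fin nB)),
      R ⊆ G.nr β ∧ C ⊆ G.nl α ∧ 3 * (G.nr β \ R).card < ΔB ∧ 3 * (G.nl α \ C).card < ΔA ∧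
      ((∃ a ∈ R, E (.inl (a, α)) ≠ 0) ∨ (∃ b ∈ C, E (.inr (β, b)) ≠ 0)) ∧
      ∀ a ∈ R, ∀ b ∈ C, G.HX.mulVec E (a, b) = E (.inl (a, α)) + E (.inr (β, b)) := by
  classical
  -- If no other erroneous label reaches the columns in `C` or the rows in `R`, a check in `R × C`
  -- sees only the two qubits belonging to the generator.
  have synd : ∀ (β : Fin nB) (α : Fin nA) (R : Finset (Fin nA)) (C : Finset (Fin nB)),
      R ⊆ G.nr β → C ⊆ G.nl α →
      (∀ b ∈ C, ∀ α', α' ≠ α → b ∈ G.nl α' → ∀ a, E (.inl (a, α')) = 0) →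
      (∀ a ∈ R, ∀ β', β' ≠ β → a ∈ G.nr β' → ∀ b ∈ C, E (.inr (β', b)) = 0) →
      ∀ a ∈ R, ∀ b ∈ C, G.HX.mulVec E (a, b) = E (.inl (a, α)) + E (.inr (β, b)) := by
    intro β α R C hR hC h1 h2 a ha b hb
    rw [HX_mulVec, Finset.sum_eq_single α, Finset.sum_eq_single β]
    · intro β' hβ' hne
      exact h2 a ha β' hne (mem_nr.2 (mem_nl.1 hβ')) b hb
    · intro h; exact absurd (mem_nl.2 (mem_nr.1 (hR ha))) h
    · intro α' hα' hne
      exact h1 b hb α' hne (mem_nl.2 (mem_nr.1 hα')) a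
    · intro h; exact absurd (mem_nr.2 (mem_nl.1 (hC hb))) h
  have expA : ∀ S : Finset (Fin nA), S.Nonempty → S.card ≤ hammingNorm E → ∃ α ∈ S,
      3 * ((G.nl α).filter fun k => ∃ i' ∈ S, i' ≠ α ∧ k ∈ G.nl i').card < ΔA := by
    intro S hS hc
    convert exists_card_shared_lt G.nl ΔA δA hΔA hδA hG.1 S hS ?_
    rw [← leftNeighbors_eq_biUnion]
    exact hlA S (le_trans (by exact_mod_cast hc) hA)
  have expB : ∀ S : Finset (Fin nB), S.Nonempty → S.card ≤ hammingNorm E → ∃ β ∈ S,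
      3 * ((G.nr β).filter fun k => ∃ i' ∈ S, i' ≠ β ∧ k ∈ G.nr i').card < ΔB := by
    intro S hS hc
    convert exists_card_shared_lt G.nr ΔB δB hΔB hδB hG.2 S hS ?_
    rw [← rightNeighbors_eq_biUnion]
    exact hrB S (le_trans (by exact_mod_cast hc) hB)
  by_cases hAA : ∃ a α, E (.inl (a, α)) ≠ 0
  · set SA : Finset (Fin nA) := (Finset.univ.filter fun p : Fin nA × Fin nA =>
      E (.inl p) ≠ 0).image Prod.snd with hSA
    have memSA : ∀ α, α ∈ SA ↔ ∃ a, E (.inl (a, α)) ≠ 0 := by simp [hSA]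
    obtain ⟨a₀, α₀, h₀⟩ := hAA
    obtain ⟨α, hα, hshare⟩ := expA SA ⟨α₀, (memSA _).2 ⟨a₀, h₀⟩⟩
      (card_image_le_hammingNorm E _ Sum.inl_injective _ _ fun k hk => hk)
    obtain ⟨a, ha⟩ := (memSA _).1 hα
    set C := (G.nl α).filter fun k => ¬ ∃ i' ∈ SA, i' ≠ α ∧ k ∈ G.nl i' with hC
    have hC1 : ∀ b ∈ C, ∀ α', α' ≠ α → b ∈ G.nl α' → ∀ a, E (.inl (a, α')) = 0 := by
      intro b hb α' hne hb' a
      by_contra hcon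
      exact (Finset.mem_filter.1 hb).2 ⟨α', (memSA _).2 ⟨a, hcon⟩, hne, hb'⟩
    -- Only `B²` errors in the columns of `C` can disturb the checks in `R × C`, so `β` is chosen
    -- after `C`, among the labels of these errors.
    set SB : Finset (Fin nB) := (Finset.univ.filter fun p : Fin nB × Fin nB =>
      E (.inr p) ≠ 0 ∧ p.2 ∈ C).image Prod.fst with hSB
    have memSB : ∀ β, β ∈ SB ↔ ∃ b, E (.inr (β, b)) ≠ 0 ∧ b ∈ C := by simp [hSB]
    by_cases hSBe : SB.Nonempty
    · obtain ⟨β, hβ, hshareB⟩ := expB SB hSBe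
        (card_image_le_hammingNorm E _ Sum.inr_injective _ _ fun k hk => hk.1)
      obtain ⟨b, hb, hbC⟩ := (memSB _).1 hβ
      refine ⟨β, α, (G.nr β).filter fun k => ¬ ∃ i' ∈ SB, i' ≠ β ∧ k ∈ G.nr i', C,
        Finset.filter_subset _ _, Finset.filter_subset _ _, ?_, ?_, .inr ⟨b, hbC, hb⟩,
        synd _ _ _ _ (Finset.filter_subset _ _) (Finset.filter_subset _ _) hC1 ?_⟩
      · rwa [sdiff_filter_not_eq]
      · rwa [hC, sdiff_filter_not_eq]
      · intro a ha β' hne ha' b hb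
        by_contra hcon
        exact (Finset.mem_filter.1 ha).2 ⟨β', (memSB _).2 ⟨b, hcon, hb⟩, hne, ha'⟩
    -- No `B²` error meets `C`, so every row is controlled. Any neighbour `β` of `a` will do; it
    -- puts the erroneous qubit `(a, α)` into the generator.
    · obtain ⟨β, hβ⟩ : (G.nl a).Nonempty := Finset.card_pos.1 (by rw [nl, hG.1 a]; exact hΔA)
      refine ⟨β, α, G.nr β, C, le_rfl, Finset.filter_subset _ _, by simpa using hΔB, ?_,
        .inl ⟨a, mem_nr.2 (mem_nl.1 hβ), ha⟩,
        synd _ _ _ _ le_rfl (Finset.filter_subset _ _) hC1 ?_⟩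
      · rwa [hC, sdiff_filter_not_eq]
      · intro a ha β' hne ha' b hb
        by_contra hcon
        exact hSBe ⟨β', (memSB _).2 ⟨b, hcon, hb⟩⟩
  · push Not at hAA
    obtain ⟨β₀, b₀, h₀⟩ : ∃ β b, E (.inr (β, b)) ≠ 0 := by
      by_contra! hBB
      exact hE (funext fun q => by rcases q with ⟨a, α⟩ | ⟨β, b⟩ <;> simp [hAA, hBB])
    set SB : Finset (Fin nB) := (Finset.univ.filter fun p : Fin nB × Fin nB =>
      E (.inr p) ≠ 0).image Prod.fst with hSB
    have memSB : ∀ β, β ∈ SB ↔ ∃ b, E (.inr (β, b)) ≠ 0 := by simp [hSB]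
    obtain ⟨β, hβ, hshareB⟩ := expB SB ⟨β₀, (memSB _).2 ⟨b₀, h₀⟩⟩
        (card_image_le_hammingNorm E _ Sum.inr_injective _ _ fun k hk => hk)
    obtain ⟨b, hb⟩ := (memSB _).1 hβ
    -- Without `A²` errors all columns are controlled, and `α` only has to put the erroneous qubit
    -- `(β, b)` into the generator.
    obtain ⟨α, hα⟩ : (G.nr b).Nonempty := Finset.card_pos.1 (by rw [nr, hG.2 b]; exact hΔB)
    refine ⟨β, α, (G.nr β).filter fun k => ¬ ∃ i' ∈ SB, i' ≠ β ∧ k ∈ G.nr i', G.nl α,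
        Finset.filter_subset _ _, le_rfl, ?_, by simpa using hΔA,
        .inr ⟨b, mem_nl.2 (mem_nr.1 hα), hb⟩,
        synd _ _ _ _ (Finset.filter_subset _ _) le_rfl (fun _ _ _ _ _ _ => hAA _ _) ?_⟩
    · rwa [sdiff_filter_not_eq]
    · intro a ha β' hne ha' b hb
      by_contra hcon
      exact (Finset.mem_filter.1 ha).2 ⟨β', (memSB _).2 ⟨b, hcon⟩, hne, ha'⟩

end BipartiteGraph

/-! ### Good flips and stuck decoders -/

namespace BipartiteGraph

variable {nA nB : ℕ} (G : BipartiteGraph nA nB)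

/-- At most half of the qubits of a generator carry errors of minimal weight in their class. -/
theorem two_mul_card_le_of_minimal (E : Qubit nA nB → ZMod 2) (β : Fin nB) (α : Fin nA)
    (hmin : hammingNorm E ≤ hammingNorm (E + G.HZ.row (β, α)))
    (x : Finset (Fin nA)) (y : Finset (Fin nB)) (hx : x ⊆ G.nr β) (hy : y ⊆ G.nl α)
    (hxE : ∀ a ∈ x, E (.inl (a, α)) ≠ 0) (hyE : ∀ b ∈ y, E (.inr (β, b)) ≠ 0) :
    2 * (x.card + y.card) ≤ (G.nr β).card + (G.nl α).card := by
  rw [HZ_row] at hmin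
  -- Adding a generator with `k` erroneous qubits changes the weight by its size minus `2k`, which
  -- minimality makes non-negative.
  have h := hammingNorm_add_indicator E (flipVec β α (G.nr β) (G.nl α))
    ((G.nr β ×ˢ {α}).disjSum ({β} ×ˢ G.nl α))
    (by rintro (⟨a, a'⟩ | ⟨b, b'⟩) h <;> simp_all [flipVec])
    (by rintro (⟨a, a'⟩ | ⟨b, b'⟩) h <;> simp_all [flipVec] <;> tauto)
  rw [Finset.card_disjSum, Finset.card_product, Finset.card_product] at h
  have h2 : x.card + y.card ≤
      (((G.nr β ×ˢ {α}).disjSum ({β} ×ˢ G.nl α)).filter fun q => E q ≠ 0).card := by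
    calc x.card + y.card = ((x ×ˢ {α}).disjSum ({β} ×ˢ y)).card := by
          simp [Finset.card_disjSum]
      _ ≤ _ := by
          refine Finset.card_le_card fun q hq => ?_
          rcases q with ⟨a, a'⟩ | ⟨b, b'⟩
          · simp only [Finset.inl_mem_disjSum, Finset.mem_product, Finset.mem_singleton,
              Finset.mem_filter] at hq ⊢
            obtain ⟨ha, rfl⟩ := hq
            exact ⟨⟨hx ha, rfl⟩, hxE a ha⟩
          · simp only [Finset.inr_mem_disjSum, Finset.mem_product, Finset.mem_singleton,
              Finset.mem_filter] at hq ⊢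
            obtain ⟨rfl, hb⟩ := hq
            exact ⟨⟨rfl, hy hb⟩, hyE b' hb⟩
  simp only [Finset.card_singleton, mul_one, one_mul] at h
  omega

/-- The flip `(x, y)` at the generator `(β, α)` lowers the weight of the syndrome `s` by at least
a third of the number of flipped qubits. -/
def IsGoodFlip (s : Fin nA × Fin nB → ZMod 2) (β : Fin nB) (α : Fin nA) (x : Finset (Fin nA))
    (y : Finset (Fin nB)) : Prop :=
  1 ≤ x.card + y.card ∧
    3 * hammingNorm (s + G.HX.mulVec (flipVec β α x y)) + (x.card + y.card) ≤ 3 * hammingNorm s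

-- The syndrome depends only on the class of `E` modulo the row space of `H_Z`, so a lightest
-- representative may be used. It is non-zero and within the range of expansion, and minimality
-- bounds its part in a critical generator by one half.
variable {G} in
theorem exists_isGoodFlip {ΔA ΔB : ℕ} (hΔA : 0 < ΔA) (hΔB : 0 < ΔB) (hG : G.IsBiregular ΔA ΔB)
    {γA δA γB δB : ℝ} (hlA : G.IsLeftExpanding ΔA γA δA) (hrB : G.IsRightExpanding ΔB γB δB)
    (hδA : δA < 1 / 6) (hδB : δB < 1 / 6) (E : Qubit nA nB → ZMod 2) (hE : E ∉ rowSpace G.HZ)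
    (hA : (hammingNorm E : ℝ) ≤ γA * nA) (hB : (hammingNorm E : ℝ) ≤ γB * nB) :
    ∃ β α x y, x ⊆ G.nr β ∧ y ⊆ G.nl α ∧ G.IsGoodFlip (G.HX.mulVec E) β α x y := by
  classical
  obtain ⟨f, hf, hmin⟩ := Set.exists_min_image (rowSpace G.HZ : Set (Qubit nA nB → ZMod 2))
    (fun f => hammingNorm (E + f)) (Set.toFinite _) ⟨0, Submodule.zero_mem _⟩
  have hle : hammingNorm (E + f) ≤ hammingNorm E := by
    simpa using hmin 0 (Submodule.zero_mem _)
  have hle' : (hammingNorm (E + f) : ℝ) ≤ hammingNorm E := by exact_mod_cast hle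
  have hne : E + f ≠ 0 := by
    intro h
    rw [eq_neg_of_add_eq_zero_left h] at hE
    exact hE (Submodule.neg_mem _ hf)
  have hsyn : G.HX.mulVec E = G.HX.mulVec (E + f) := by
    rw [Matrix.mulVec_add, HX_mulVec_of_mem_rowSpace G hf, add_zero]
  have hmin' : ∀ β α, hammingNorm (E + f) ≤ hammingNorm (E + f + G.HZ.row (β, α)) := by
    intro β α
    rw [add_assoc]
    exact hmin _ (Submodule.add_mem _ hf (Submodule.subset_span ⟨_, rfl⟩))
  rw [hsyn]
  generalize E + f = E' at *
  obtain ⟨β, α, R, C, hR, hC, hRc, hCc, hex, hs⟩ := exists_critical G hΔA hΔB hG hlA hrB hδA hδB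
    E' hne (hle'.trans hA) (hle'.trans hB)
  set x₁ := R.filter fun a => E' (.inl (a, α)) ≠ 0 with hx₁
  set x₂ := R.filter fun a => ¬ E' (.inl (a, α)) ≠ 0 with hx₂
  set y₁ := C.filter fun b => E' (.inr (β, b)) ≠ 0 with hy₁
  set y₂ := C.filter fun b => ¬ E' (.inr (β, b)) ≠ 0 with hy₂
  have hxu : x₁ ∪ x₂ = R := Finset.filter_union_filter_not_eq _ _
  have hyu : y₁ ∪ y₂ = C := Finset.filter_union_filter_not_eq _ _
  have hxd : Disjoint x₁ x₂ := Finset.disjoint_filter_filter_not _ _ _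
  have hyd : Disjoint y₁ y₂ := Finset.disjoint_filter_filter_not _ _ _
  have hcx : x₁.card + x₂.card = R.card := Finset.card_filter_add_card_filter_not _
  have hcy : y₁.card + y₂.card = C.card := Finset.card_filter_add_card_filter_not _
  have hcR := Finset.card_sdiff_add_card_eq_card hR
  have hcC := Finset.card_sdiff_add_card_eq_card hC
  have hdR : (G.nr β).card = ΔB := hG.2 β
  have hdC : (G.nl α).card = ΔA := hG.1 α
  have hx₁R : x₁ ⊆ R := Finset.filter_subset _ _
  have hy₁C : y₁ ⊆ C := Finset.filter_subset _ _
  have hred := G.two_mul_card_le_of_minimal E' β α (hmin' β α) x₁ y₁ (hx₁R.trans hR)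
    (hy₁C.trans hC) (fun a ha => (Finset.mem_filter.1 ha).2) (fun b hb => (Finset.mem_filter.1 hb).2)
  have hpos : 1 ≤ x₁.card + y₁.card := by
    rcases hex with ⟨a, ha, h⟩ | ⟨b, hb, h⟩
    · have : 0 < x₁.card := Finset.card_pos.2 ⟨a, Finset.mem_filter.2 ⟨ha, h⟩⟩
      omega
    · have : 0 < y₁.card := Finset.card_pos.2 ⟨b, Finset.mem_filter.2 ⟨hb, h⟩⟩
      omega
  obtain ⟨i₁, i₂, j₁, j₂, hone, hgain⟩ := exists_block_flip x₁.card x₂.card y₁.card y₂.card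
    (G.nr β \ R).card (G.nl α \ C).card (Int.natCast_nonneg _) (Int.natCast_nonneg _)
    (Int.natCast_nonneg _) (Int.natCast_nonneg _) (Int.natCast_nonneg _) (Int.natCast_nonneg _)
    (by omega) (by omega) (by omega) (by omega)
  set x := (if i₁ then x₁ else ∅) ∪ (if i₂ then x₂ else ∅) with hx
  set y := (if j₁ then y₁ else ∅) ∪ (if j₂ then y₂ else ∅) with hy
  have hxs : x ⊆ x₁ ∪ x₂ := by
    refine Finset.union_subset_union ?_ ?_ <;> split_ifs <;> simp
  have hys : y ⊆ y₁ ∪ y₂ := by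
    refine Finset.union_subset_union ?_ ?_ <;> split_ifs <;> simp
  have hxc : (x.card : ℤ) = (if i₁ then (x₁.card : ℤ) else 0) + (if i₂ then (x₂.card : ℤ) else 0) := by
    rw [hx, Finset.card_union_of_disjoint]
    · push_cast; congr 1 <;> split_ifs <;> simp
    · split_ifs <;> simp [hxd]
  have hyc : (y.card : ℤ) = (if j₁ then (y₁.card : ℤ) else 0) + (if j₂ then (y₂.card : ℤ) else 0) := by
    rw [hy, Finset.card_union_of_disjoint]
    · push_cast; congr 1 <;> split_ifs <;> simp
    · split_ifs <;> simp [hyd]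
  rw [← hxc, ← hyc] at hone hgain
  have hxd' : ∀ a, a ∈ x₁ → a ∉ x₂ := fun a h => Finset.disjoint_left.1 hxd h
  have hyd' : ∀ a, a ∈ y₁ → a ∉ y₂ := fun a h => Finset.disjoint_left.1 hyd h
  have hbound := hammingNorm_add_grid_le (G.HX.mulVec E') (G.nr β) x₁ x₂ x (G.nl α) y₁ y₂ y
    i₁ i₂ j₁ j₂ hxd hyd hxs hys (hxu ▸ hR) (hyu ▸ hC)
    (fun a ha => by cases i₁ <;> cases i₂ <;> simp [hx, ha, hxd' a ha])
    (fun a ha => by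
      have : a ∉ x₁ := fun h => hxd' a h ha
      cases i₁ <;> cases i₂ <;> simp [hx, ha, this])
    (fun a ha => by cases j₁ <;> cases j₂ <;> simp [hy, ha, hyd' a ha])
    (fun a ha => by
      have : a ∉ y₁ := fun h => hyd' a h ha
      cases j₁ <;> cases j₂ <;> simp [hy, ha, this])
    (fun a ha b hb => by
      rw [hxu] at ha; rw [hyu] at hb
      have h01 : ∀ u : ZMod 2, u = if u ≠ 0 then 1 else 0 := by decide
      rw [hs a ha b hb, h01 (E' (.inl (a, α))), h01 (E' (.inr (β, b)))]
      simp [hx₁, hy₁, ha, hb])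
  rw [hxu, hyu, ← HX_mulVec_flipVec] at hbound
  refine ⟨β, α, x, y, (hxs.trans hxu.le).trans hR, (hys.trans hyu.le).trans hC, ?_, ?_⟩
  · omega
  · zify
    linarith

variable {G} in
/-- If a small-set-flip decoder gets stuck, then it has corrected the error. -/
theorem add_mem_rowSpace_of_stuck {ΔA ΔB : ℕ} (hΔA : 0 < ΔA) (hΔB : 0 < ΔB) (hnA : 0 < nA)
    (hn : nB ≤ nA) (hG : G.IsBiregular ΔA ΔB)
    {γA δA γB δB : ℝ} (hlA : G.IsLeftExpanding ΔA γA δA) (hrB : G.IsRightExpanding ΔB γB δB)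
    (hδA : δA < 1 / 6) (hδB : δB < 1 / 6) (e o : Qubit nA nB → ZMod 2)
    (he : (hammingNorm e : ℝ) < 1 / (3 * (1 + (ΔB : ℝ))) * min (γA * nA) (γB * nB))
    (ho : 3 * hammingNorm (G.HX.mulVec (e + o)) + hammingNorm o ≤
      3 * hammingNorm (G.HX.mulVec e))
    (hstuck : ∀ β α x y, x ⊆ G.nr β → y ⊆ G.nl α →
      ¬ G.IsGoodFlip (G.HX.mulVec (e + o)) β α x y) : e + o ∈ rowSpace G.HZ := by
  by_contra hcon
  have h1 := hammingNorm_HX_mulVec_le hG hnA hn e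
  -- Dropping the syndrome term in `ho` leaves `|o| ≤ 3|H_X e| ≤ 3Δ_B|e|`. Since `1 + 3Δ_B ≤ 3(1 +
  -- Δ_B)`, the denominator in `w₀` suffices.
  have h2 : hammingNorm (e + o) ≤ (1 + 3 * ΔB) * hammingNorm e := by
    have := hammingNorm_add_le e o
    nlinarith
  have h3 : (hammingNorm (e + o) : ℝ) ≤ (1 + 3 * ΔB) * hammingNorm e := by exact_mod_cast h2
  have h4 : (hammingNorm (e + o) : ℝ) ≤ min (γA * nA) (γB * nB) := by
    have h5 : (0 : ℝ) < 3 * (1 + (ΔB : ℝ)) := by positivity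
    rw [div_mul_eq_mul_div, one_mul, lt_div_iff₀ h5] at he
    have : (0 : ℝ) ≤ hammingNorm e := by positivity
    nlinarith
  obtain ⟨β, α, x, y, hx, hy, h⟩ := exists_isGoodFlip hΔA hΔB hG hlA hrB hδA hδB (e + o) hcon
    (h4.trans (min_le_left _ _)) (h4.trans (min_le_right _ _))
  exact hstuck β α x y hx hy h

/-! ### Exchange of the two types of errors, and locality of good flips -/

/-- Exchange of the two tensor factors. -/
def swapQubit : Qubit nA nB → Qubit nA nB := Sum.map Prod.swap Prod.swap

theorem HX_mulVec_comp_swapQubit (e : Qubit nA nB → ZMod 2) :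
    G.HX.mulVec (e ∘ swapQubit) = G.HZ.mulVec e ∘ Prod.swap := by
  funext ⟨a, b⟩
  simp only [Function.comp, Prod.swap, HX_mulVec, HZ_mulVec]
  rfl

theorem swapQubit_swapQubit (q : Qubit nA nB) : swapQubit (swapQubit q) = q := by
  rcases q with ⟨a, a'⟩ | ⟨b, b'⟩ <;> rfl

theorem HX_row_swap (p : Fin nB × Fin nA) :
    G.HX.row p.swap = G.HZ.row p ∘ swapQubit := by
  funext q
  obtain ⟨β, α⟩ := p
  rcases q with ⟨a, a'⟩ | ⟨b, b'⟩ <;> simp [HX, HZ, swapQubit, mul_comm]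

variable {G} in
theorem comp_swapQubit_mem_rowSpace {f : Qubit nA nB → ZMod 2} (hf : f ∈ rowSpace G.HZ) :
    f ∘ swapQubit ∈ rowSpace G.HX := by
  have : rowSpace G.HZ ≤ (rowSpace G.HX).comap
      (LinearMap.funLeft (ZMod 2) (ZMod 2) (swapQubit (nA := nA) (nB := nB))) := by
    refine Submodule.span_le.2 ?_
    rintro _ ⟨p, rfl⟩
    refine Submodule.subset_span ⟨p.swap, ?_⟩
    rw [HX_row_swap]
    rfl
  exact this hf

theorem hammingNorm_comp_swapQubit (e : Qubit nA nB → ZMod 2) :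
    hammingNorm (e ∘ swapQubit) = hammingNorm e := by
  rw [hammingNorm_eq_sum, hammingNorm_eq_sum]
  exact Equiv.sum_comp (⟨swapQubit, swapQubit, swapQubit_swapQubit, swapQubit_swapQubit⟩ :
    Qubit nA nB ≃ Qubit nA nB) fun q => if e q = 0 then 0 else 1

/-- A good flip at a generator remains good when the syndrome changes elsewhere. -/
theorem IsGoodFlip.congr {s s' : Fin nA × Fin nB → ZMod 2} {β : Fin nB} {α : Fin nA}
    {x : Finset (Fin nA)} {y : Finset (Fin nB)} (hx : x ⊆ G.nr β) (hy : y ⊆ G.nl α)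
    (h : G.IsGoodFlip s β α x y) (hs : ∀ a ∈ G.nr β, ∀ b ∈ G.nl α, s' (a, b) = s (a, b)) :
    G.IsGoodFlip s' β α x y := by
  refine ⟨h.1, ?_⟩
  have h2 := h.2
  zify at h2 ⊢
  rw [hammingNorm_add_eq] at h2 ⊢
  have : ∑ p, flipGain (s' p) (G.HX.mulVec (flipVec β α x y) p) =
      ∑ p, flipGain (s p) (G.HX.mulVec (flipVec β α x y) p) := by
    refine Finset.sum_congr rfl fun ⟨a, b⟩ _ => ?_
    by_cases hab : a ∈ G.nr β ∧ b ∈ G.nl α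
    · rw [hs a hab.1 b hab.2]
    · have : G.HX.mulVec (flipVec β α x y) (a, b) = 0 := by
        have h1 : ¬ (a ∈ x ∧ b ∈ G.nl α) := fun h => hab ⟨hx h.1, h.2⟩
        have h2 : ¬ (b ∈ y ∧ a ∈ G.nr β) := fun h => hab ⟨h.2, hy h.1⟩
        rw [HX_mulVec_flipVec]
        simp only [if_neg h1, if_neg h2, add_zero]
      rw [this]; simp [flipGain]
  rw [this]
  linarith

end BipartiteGraph

/-! ### Reasoning about programs -/

namespace RAM

@[simp] theorem State.setReg_reg (s : State) (x v y : ℕ) :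
    (s.setReg x v).reg y = if y = x then v else s.reg y := by
  simp [State.setReg, Function.update_apply]

@[simp] theorem State.setReg_arr (s : State) (x v : ℕ) : (s.setReg x v).arr = s.arr := rfl

@[simp] theorem State.setArr_reg (s : State) (a i v : ℕ) : (s.setArr a i v).reg = s.reg := rfl

theorem State.setArr_arr (s : State) (a i v b j : ℕ) :
    (s.setArr a i v).arr b j = if b = a ∧ j = i then v else s.arr b j := by
  by_cases h : b = a
  · subst h; simp [State.setArr, Function.update_apply]
  · simp [State.setArr, h]

theorem State.setArr_arr_of_ne (s : State) {a b : ℕ} (i v : ℕ) (h : b ≠ a) :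
    (s.setArr a i v).arr b = s.arr b := by
  simp [State.setArr, Function.update_of_ne h]

attribute [simp] Expr.eval

namespace Program

/-- `p.Runs s T Q`: started in `s`, the program `p` halts within time `T` in a state with `Q`. -/
def Runs (p : Program) (s : State) (T : ℕ) (Q : State → Prop) : Prop :=
  ∃ t s', Exec p s t s' ∧ t ≤ T ∧ Q s'

theorem Runs.mono {p : Program} {s : State} {T T' : ℕ} {Q Q' : State → Prop}
    (h : p.Runs s T Q) (hT : T ≤ T') (hQ : ∀ s', Q s' → Q' s') : p.Runs s T' Q' := by
  obtain ⟨t, s', he, ht, hq⟩ := h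
  exact ⟨t, s', he, ht.trans hT, hQ _ hq⟩

theorem Runs.seq {p q : Program} {s : State} {T₁ T₂ : ℕ} {R Q : State → Prop}
    (hp : p.Runs s T₁ R) (hq : ∀ s', R s' → q.Runs s' T₂ Q) :
    (Program.seq p q).Runs s (T₁ + T₂) Q := by
  obtain ⟨t₁, s₁, he₁, ht₁, hr⟩ := hp
  obtain ⟨t₂, s₂, he₂, ht₂, hq⟩ := hq _ hr
  exact ⟨_, _, .seq he₁ he₂, by omega, hq⟩

/-- A program without loops. -/
def LoopFree : Program → Prop
  | skip => True
  | assign _ _ => True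
  | put _ _ _ => True
  | seq p q => p.LoopFree ∧ q.LoopFree
  | cond _ p q => p.LoopFree ∧ q.LoopFree
  | loop _ _ => False

/-- The state reached by a program without loops. -/
def run : Program → State → State
  | skip, s => s
  | assign x e, s => s.setReg x (e.eval s)
  | put a i e, s => s.setArr a (i.eval s) (e.eval s)
  | seq p q, s => q.run (p.run s)
  | cond e p q, s => if e.eval s = 0 then q.run s else p.run s
  | loop _ _, s => s

/-- An upper bound for the running time of a program without loops. -/
def timeBound : Program → ℕ
  | skip => 1
  | assign _ e => e.cost + 1
  | put _ i e => i.cost + e.cost + 1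
  | seq p q => p.timeBound + q.timeBound
  | cond e p q => e.cost + 1 + (p.timeBound + q.timeBound)
  | loop _ _ => 0

theorem LoopFree.runs {p : Program} (hp : p.LoopFree) (s : State) :
    p.Runs s p.timeBound (· = p.run s) := by
  induction p generalizing s with
  | skip => exact ⟨_, _, .skip s, le_rfl, rfl⟩
  | assign x e => exact ⟨_, _, .assign x e s, le_rfl, rfl⟩
  | put a i e => exact ⟨_, _, .put a i e s, le_rfl, rfl⟩
  | seq p q ihp ihq =>
    refine (ihp hp.1 s).seq fun s' h => ?_
    subst h
    exact ihq hp.2 _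
  | cond e p q ihp ihq =>
    by_cases h : e.eval s = 0
    · obtain ⟨t, s', he, ht, hs⟩ := ihq hp.2 s
      exact ⟨_, _, .cond_false h he, by simp only [timeBound]; omega, by simp [run, h, hs]⟩
    · obtain ⟨t, s', he, ht, hs⟩ := ihp hp.1 s
      exact ⟨_, _, .cond_true h he, by simp only [timeBound]; omega, by simp [run, h, hs]⟩
  | loop e p => exact hp.elim

theorem LoopFree.runs_of {p : Program} (hp : p.LoopFree) {s : State} {Q : State → Prop}
    (h : Q (p.run s)) : p.Runs s p.timeBound Q :=
  (hp.runs s).mono le_rfl fun _ hs => hs ▸ h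

/-- Loops whose variant decreases in each round. -/
theorem Runs.loop {e : Expr} {p : Program} {T : ℕ} (Inv : ℕ → State → Prop)
    (hstep : ∀ m s, Inv m s → e.eval s ≠ 0 → p.Runs s T fun s' => ∃ m' < m, Inv m' s')
    (m : ℕ) (s : State) (h : Inv m s) :
    (Program.loop e p).Runs s (m * (e.cost + 1 + T) + (e.cost + 1))
      fun s' => e.eval s' = 0 ∧ ∃ m', Inv m' s' := by
  induction m using Nat.strong_induction_on generalizing s with
  | _ m ih =>
    by_cases he : e.eval s = 0
    · exact ⟨_, _, .loop_false he, by omega, he, m, h⟩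
    · obtain ⟨t₁, s₁, he₁, ht₁, m', hm', h'⟩ := hstep m s h he
      obtain ⟨t₂, s₂, he₂, ht₂, hq⟩ := ih m' hm' s₁ h'
      refine ⟨_, _, .loop_true he he₁ he₂, ?_, hq⟩
      have : (m' + 1) * (e.cost + 1 + T) ≤ m * (e.cost + 1 + T) := Nat.mul_le_mul_right _ hm'
      nlinarith

/-- `for x in 0, …, n - 1 do p`, where `n` is the content of register `n`. -/
def forLoop (x n : ℕ) (p : Program) : Program :=
  .seq (.assign x (.lit 0)) (.loop (.sub (.reg n) (.reg x))
    (.seq p (.assign x (.add (.reg x) (.lit 1)))))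

/-- Each round adds 4 units for the test and 4 for the increment; the final 6 are the initialisation
(2) and the failing test (4). The invariant must ignore register `x`, which the loop itself
overwrites. -/
theorem Runs.forLoop {x n : ℕ} {p : Program} {T : ℕ} (hxn : x ≠ n) (N : ℕ)
    (J : ℕ → State → Prop) (hJ : ∀ k s v, J k s → J k (s.setReg x v))
    (hstep : ∀ k < N, ∀ s, J k s → s.reg x = k → s.reg n = N → p.Runs s T fun s' =>
      J (k + 1) s' ∧ s'.reg x = k ∧ s'.reg n = N)
    (s : State) (h : J 0 s) (hn : s.reg n = N) :
    (Program.forLoop x n p).Runs s (N * (T + 8) + 6) fun s' => J N s' ∧ s'.reg n = N := by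
  have h1 : (Program.assign x (.lit 0)).Runs s 2 fun s' =>
      J 0 s' ∧ s'.reg x = 0 ∧ s'.reg n = N :=
    ⟨_, _, .assign x _ s, le_rfl, hJ _ _ _ h, by simp, by simp [hxn.symm, hn]⟩
  refine (h1.seq fun s₁ hs₁ => Runs.mono (Runs.loop (T := T + 4)
    (fun m s' => ∃ k, m + k = N ∧ J k s' ∧ s'.reg x = k ∧ s'.reg n = N) ?_ N s₁ ?_)
      le_rfl ?_).mono ?_ fun _ h => h
  · rintro m s' ⟨k, hmk, hJk, hx, hn'⟩ he
    simp only [Expr.eval, hx, hn'] at he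
    refine Runs.seq (hstep k (by omega) s' hJk hx hn') fun s'' hs'' => ?_
    refine ⟨_, _, .assign x _ s'', le_rfl, m - 1, by omega, k + 1, by omega,
      hJ _ _ _ hs''.1, by simp [hs''.2.1], by simp [hxn.symm, hs''.2.2]⟩
  · exact ⟨0, rfl, hs₁⟩
  · rintro s' ⟨he, m, k, hmk, hJk, hx, hn'⟩
    simp only [Expr.eval, hx, hn'] at he
    obtain rfl : k = N := by omega
    exact ⟨hJk, hn'⟩
  · simp only [Expr.cost]
    ring_nf; omega

/-- Two nested loops: register `2` runs below register `1` and register `3` below register `0`. -/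
def forLoop₂ (p : Program) : Program := forLoop 2 1 (forLoop 3 0 p)

theorem Runs.forLoop₂ {p : Program} {T : ℕ} (nA nB : ℕ) (J : ℕ → ℕ → State → Prop)
    (hJ₂ : ∀ k l s v, J k l s → J k l (s.setReg 2 v))
    (hJ₃ : ∀ k l s v, J k l s → J k l (s.setReg 3 v))
    (hroll : ∀ k s, J k nA s → J (k + 1) 0 s)
    (hstep : ∀ k < nB, ∀ l < nA, ∀ s, J k l s → s.reg 0 = nA → s.reg 1 = nB → s.reg 2 = k →
      s.reg 3 = l → p.Runs s T fun s' => J k (l + 1) s' ∧ s'.reg 0 = nA ∧ s'.reg 1 = nB ∧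
        s'.reg 2 = k ∧ s'.reg 3 = l)
    (s : State) (h : J 0 0 s) (h0 : s.reg 0 = nA) (h1 : s.reg 1 = nB) :
    (Program.forLoop₂ p).Runs s (nB * (nA * (T + 8) + 6 + 8) + 6) fun s' =>
      J nB 0 s' ∧ s'.reg 0 = nA ∧ s'.reg 1 = nB := by
  refine (Runs.forLoop (by decide) nB (fun k s => J k 0 s ∧ s.reg 0 = nA) ?_ ?_ s ⟨h, h0⟩ h1).mono
    le_rfl fun s' h => ⟨h.1.1, h.1.2, h.2⟩
  · rintro k s v ⟨h, h0⟩
    exact ⟨hJ₂ _ _ _ _ h, by simp [h0]⟩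
  · rintro k hk s ⟨h, h0⟩ h2 h1
    refine (Runs.forLoop (by decide) nA (fun l s => J k l s ∧ s.reg 1 = nB ∧ s.reg 2 = k) ?_ ?_ s
      ⟨h, h1, h2⟩ h0).mono le_rfl fun s' h => ⟨⟨hroll _ _ h.1.1, h.2⟩, h.1.2.2, h.1.2.1⟩
    · rintro l s v ⟨h, h1, h2⟩
      exact ⟨hJ₃ _ _ _ _ h, by simp [h1], by simp [h2]⟩
    · rintro l hl s ⟨h, h1, h2⟩ h3 h0
      exact (hstep k hk l hl s h h0 h1 h2 h3).mono le_rfl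
        fun s' ⟨h, h0, h1, h2, h3⟩ => ⟨⟨h, h1, h2⟩, h3, h0⟩

/-- The programs of a list, one after the other. -/
def seqList (l : List Program) : Program := l.foldr .seq .skip

theorem loopFree_seqList {l : List Program} (h : ∀ p ∈ l, p.LoopFree) : (seqList l).LoopFree := by
  induction l with
  | nil => trivial
  | cons p l ih =>
    exact ⟨h p (by simp), ih fun q hq => h q (by simp [hq])⟩

@[simp] theorem run_seqList_nil (s : State) : (seqList []).run s = s := rfl

@[simp] theorem run_seqList_cons (p : Program) (l : List Program) (s : State) :
    (seqList (p :: l)).run s = (seqList l).run (p.run s) := rfl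

end Program

end RAM

/-! ### The decoding program -/

namespace SmallSetFlip

open RAM Program BipartiteGraph

/-- The array that holds the `j`-th neighbours of the left vertices. -/
def nbrA (j : ℕ) : ℕ := 11 + 2 * j

/-- The array that holds the `i`-th neighbours of the right vertices. -/
def nbrB (i : ℕ) : ℕ := 12 + 2 * i

/-- The array of the syndrome, for either of the two types of errors. -/
def synArr : Bool → ℕ
  | false => 1
  | true => 2

/-- The array of the `A²` part of the output. -/
def outArrA : Bool → ℕ
  | false => 3
  | true => 5

/-- The array of the `B²` part of the output. -/
def outArrB : Bool → ℕ
  | false => 4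
  | true => 6

/-- The cell of the check `(a, b)` in the array of the syndrome; for the second type of errors all
tables are transposed. -/
def cellIdx (z : Bool) (nA nB a b : ℕ) : ℕ :=
  match z with
  | false => a * nB + b
  | true => b * nA + a

/-- The cell of the pair `(i, j)` in an output array with rows of length `n`. -/
def outIdx (z : Bool) (n i j : ℕ) : ℕ :=
  match z with
  | false => i * n + j
  | true => j * n + i

/-- The expression that computes `cellIdx`. -/
def cellExpr (z : Bool) (a b : Expr) : Expr :=
  match z with
  | false => .add (.get 8 a) b
  | true => .add (.get 7 b) a

/-- The expression that computes `outIdx`, given the array of multiples of the row length. -/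
def outExpr (z : Bool) (m : ℕ) (i j : Expr) : Expr :=
  match z with
  | false => .add (.get m i) j
  | true => .add (.get m j) i

/-- The `i`-th neighbour of the right vertex in register `7`. -/
def rowExpr (i : ℕ) : Expr := .get (nbrB i) (.reg 7)

/-- The `j`-th neighbour of the left vertex in register `8`. -/
def colExpr (j : ℕ) : Expr := .get (nbrA j) (.reg 8)

/-- Complement a bit. -/
def flipBit (m : ℕ) (e : Expr) : Program := .put m e (.sub (.lit 1) (.get m e))

/-- Complement a bit of the syndrome; register `9` counts the bits that become `1`, and register
`10` those that become `0`. -/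
def flipCheck (z : Bool) (a b : Expr) : Program :=
  .seq (.assign 10 (.add (.reg 10) (.get (synArr z) (cellExpr z a b))))
    (.seq (.assign 9 (.add (.reg 9) (.sub (.lit 1) (.get (synArr z) (cellExpr z a b)))))
      (flipBit (synArr z) (cellExpr z a b)))

/-- Flip the `i`-th qubit of type `A²` of the generator in registers `7`, `8`. -/
def flipRow (z : Bool) (ΔA i : ℕ) : Program :=
  .seq (seqList ((List.finRange ΔA).map fun j : Fin ΔA => flipCheck z (rowExpr i) (colExpr j)))
    (flipBit (outArrA z) (outExpr z 7 (rowExpr i) (.reg 8)))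

/-- Flip the `j`-th qubit of type `B²` of the generator in registers `7`, `8`. -/
def flipCol (z : Bool) (ΔB j : ℕ) : Program :=
  .seq (seqList ((List.finRange ΔB).map fun i : Fin ΔB => flipCheck z (rowExpr i) (colExpr j)))
    (flipBit (outArrB z) (outExpr z 8 (.reg 7) (colExpr j)))

/-- Flip a set of qubits of the generator in registers `7`, `8`. -/
noncomputable def flipSet (z : Bool) {ΔA ΔB : ℕ} (X : Finset (Fin ΔB)) (Y : Finset (Fin ΔA)) :
    Program :=
  .seq (seqList (X.toList.map fun i : Fin ΔB => flipRow z ΔA i))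
    (seqList (Y.toList.map fun j : Fin ΔA => flipCol z ΔB j))

/-- Push a generator on the stack. -/
def push (β α : Expr) : Program :=
  .seq (.put 9 (.reg 6) β) (.seq (.put 10 (.reg 6) α) (.assign 6 (.add (.reg 6) (.lit 1))))

/-- Push all generators that share checks with the generator in registers `7`, `8`. -/
def pushNear (ΔA ΔB : ℕ) : Program :=
  seqList (((List.finRange ΔB ×ˢ List.finRange ΔA) ×ˢ (List.finRange ΔA ×ˢ List.finRange ΔB)).map
    -- Generators share a check iff they share a row and a column, so the relevant labels lie two
    -- steps away in the graph. Repetitions are harmless, and the number of pushes is fixed.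
    fun q => push (.get (nbrA q.1.2) (rowExpr q.1.1)) (.get (nbrB q.2.2) (colExpr q.2.1)))

/-- Try the given flips one after the other, until one of them is good. -/
noncomputable def tryFlips (z : Bool) {ΔA ΔB : ℕ} :
    List (Finset (Fin ΔB) × Finset (Fin ΔA)) → Program
  | [] => .skip
  | XY :: l =>
    .seq (.assign 9 (.lit 0)) (.seq (.assign 10 (.lit 0)) (.seq (flipSet z XY.1 XY.2)
      -- The truncated difference is zero exactly if three times the drop in weight covers the size
      -- of the flip. Otherwise the flip is undone by repeating it.
      (.cond (.sub (.add (.add (.reg 9) (.add (.reg 9) (.reg 9)))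
            (.lit (XY.1.card + XY.2.card))) (.add (.reg 10) (.add (.reg 10) (.reg 10))))
        (.seq (flipSet z XY.1 XY.2) (tryFlips z l)) (pushNear ΔA ΔB))))

/-- All non-empty sets of qubits of a generator. -/
noncomputable def allFlips (ΔA ΔB : ℕ) : List (Finset (Fin ΔB) × Finset (Fin ΔA)) :=
  (Finset.univ.filter fun XY : Finset (Fin ΔB) × Finset (Fin ΔA) =>
    1 ≤ XY.1.card + XY.2.card).toList

/-- One round of the decoder: pop a generator and try to flip qubits in it. -/
noncomputable def round (z : Bool) (ΔA ΔB : ℕ) : Program :=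
  .seq (.assign 6 (.sub (.reg 6) (.lit 1))) (.seq (.assign 7 (.get 9 (.reg 6)))
    (.seq (.assign 8 (.get 10 (.reg 6))) (tryFlips z (allFlips ΔA ΔB))))

/-- The decoder for one type of errors. -/
noncomputable def phase (z : Bool) (ΔA ΔB : ℕ) : Program :=
  .seq (.assign 6 (.lit 0)) (.seq (forLoop₂ (push (.reg 2) (.reg 3)))
    (.loop (.reg 6) (round z ΔA ΔB)))

theorem loopFree_flipCheck (z : Bool) (a b : Expr) : (flipCheck z a b).LoopFree :=
  ⟨trivial, trivial, trivial⟩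

theorem loopFree_flipSet (z : Bool) {ΔA ΔB : ℕ} (X : Finset (Fin ΔB)) (Y : Finset (Fin ΔA)) :
    (flipSet z X Y).LoopFree := by
  refine ⟨loopFree_seqList ?_, loopFree_seqList ?_⟩ <;> intro p hp <;>
    obtain ⟨k, -, rfl⟩ := List.mem_map.1 hp <;>
    refine ⟨loopFree_seqList ?_, trivial⟩ <;> intro p hp <;>
    obtain ⟨k, -, rfl⟩ := List.mem_map.1 hp <;> exact loopFree_flipCheck _ _ _

theorem loopFree_push (β α : Expr) : (push β α).LoopFree := ⟨trivial, trivial, trivial⟩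

theorem loopFree_pushNear (ΔA ΔB : ℕ) : (pushNear ΔA ΔB).LoopFree := by
  refine loopFree_seqList fun p hp => ?_
  obtain ⟨k, -, rfl⟩ := List.mem_map.1 hp
  exact loopFree_push _ _

theorem loopFree_tryFlips (z : Bool) {ΔA ΔB : ℕ}
    (l : List (Finset (Fin ΔB) × Finset (Fin ΔA))) : (tryFlips z l).LoopFree := by
  induction l with
  | nil => trivial
  | cons XY l ih =>
    exact ⟨trivial, trivial, loopFree_flipSet _ _ _, ⟨loopFree_flipSet _ _ _, ih⟩,
      loopFree_pushNear _ _⟩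

theorem loopFree_round (z : Bool) (ΔA ΔB : ℕ) : (round z ΔA ΔB).LoopFree :=
  ⟨trivial, trivial, trivial, loopFree_tryFlips _ _⟩

/-! ### What the memory represents -/

/-- The functions `ν` and `μ` enumerate the neighbours of the vertices. -/
structure Enumerates {nA nB : ℕ} (G : BipartiteGraph nA nB) {ΔA ΔB : ℕ}
    (ν : Fin nA → Fin ΔA → Fin nB) (μ : Fin nB → Fin ΔB → Fin nA) : Prop where
  injA : ∀ a, Function.Injective (ν a)
  injB : ∀ b, Function.Injective (μ b)
  nl_eq : ∀ a, G.nl a = Finset.univ.image (ν a)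
  nr_eq : ∀ b, G.nr b = Finset.univ.image (μ b)

/-- The tables of multiples and of neighbours are in place. -/
structure Tables {nA nB ΔA ΔB : ℕ} (ν : Fin nA → Fin ΔA → Fin nB) (μ : Fin nB → Fin ΔB → Fin nA)
    (st : State) : Prop where
  mulA : ∀ i < nA, st.arr 7 i = i * nA
  mulB : ∀ i < nA, st.arr 8 i = i * nB
  nbrA : ∀ (a : Fin nA) (j : Fin ΔA), st.arr (nbrA j) a = (ν a j : ℕ)
  nbrB : ∀ (b : Fin nB) (i : Fin ΔB), st.arr (nbrB i) b = (μ b i : ℕ)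

/-- The state `st`, reached from `st₀`, represents the syndrome `s` and the output `o`. -/
structure Rep {nA nB : ℕ} (z : Bool) (st₀ st : State) (s : Fin nA × Fin nB → ZMod 2)
    (o : Qubit nA nB → ZMod 2) : Prop where
  frame : ∀ m, m ≠ synArr z → m ≠ outArrA z → m ≠ outArrB z → m ≠ 9 → m ≠ 10 →
    st.arr m = st₀.arr m
  reg_zero : st.reg 0 = nA
  reg_one : st.reg 1 = nB
  syn : ∀ (a : Fin nA) (b : Fin nB), st.arr (synArr z) (cellIdx z nA nB a b) = (s (a, b)).val
  outA : ∀ a α : Fin nA, st.arr (outArrA z) (outIdx z nA a α) = (o (.inl (a, α))).val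
  outB : ∀ β b : Fin nB, st.arr (outArrB z) (outIdx z nB β b) = (o (.inr (β, b))).val

theorem mul_add_inj {m n : ℕ} (p q : Fin m × Fin n)
    (h : (p.1 : ℕ) * n + p.2 = q.1 * n + q.2) : p = q := by
  refine finProdFinEquiv.injective (Fin.ext ?_)
  simp only [finProdFinEquiv_apply_val]
  linarith

theorem outIdx_inj {z : Bool} {n : ℕ} (p q : Fin n × Fin n) :
    outIdx z n p.1 p.2 = outIdx z n q.1 q.2 ↔ p = q := by
  refine ⟨fun h => ?_, fun h => by rw [h]⟩
  cases z
  · exact mul_add_inj p q h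
  · exact Prod.swap_injective (mul_add_inj p.swap q.swap h)

theorem cellIdx_inj {z : Bool} {nA nB : ℕ} (p q : Fin nA × Fin nB) :
    cellIdx z nA nB p.1 p.2 = cellIdx z nA nB q.1 q.2 ↔ p = q := by
  refine ⟨fun h => ?_, fun h => by rw [h]⟩
  cases z
  · exact mul_add_inj p q h
  · exact Prod.swap_injective (mul_add_inj p.swap q.swap h)

theorem val_add_single {ι : Type*} [DecidableEq ι] (s : ι → ZMod 2) (p q : ι) :
    ((s + Pi.single p 1 : ι → ZMod 2) q).val = if q = p then 1 - (s p).val else (s q).val := by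
  have key : ∀ u : ZMod 2, (u + 1).val = 1 - u.val := by decide
  by_cases h : q = p
  · subst h; simp [key]
  · simp [h]

section

variable {nA nB : ℕ} {z : Bool} {st₀ st : State} {s : Fin nA × Fin nB → ZMod 2}
  {o : Qubit nA nB → ZMod 2}

theorem Rep.setReg (h : Rep z st₀ st s o) (x v : ℕ) (hx₀ : x ≠ 0) (hx₁ : x ≠ 1) :
    Rep z st₀ (st.setReg x v) s o where
  frame := h.frame
  reg_zero := by simp [hx₀.symm, h.reg_zero]
  reg_one := by simp [hx₁.symm, h.reg_one]
  syn := h.syn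
  outA := h.outA
  outB := h.outB

theorem Rep.setArr_stack (h : Rep z st₀ st s o) (m i v : ℕ) (hm : m = 9 ∨ m = 10) :
    Rep z st₀ (st.setArr m i v) s o where
  frame := fun k h1 h2 h3 h4 h5 => by
    rw [State.setArr_arr_of_ne _ _ _ (by omega), h.frame k h1 h2 h3 h4 h5]
  reg_zero := h.reg_zero
  reg_one := h.reg_one
  syn := fun a b => by
    rw [State.setArr_arr_of_ne _ _ _ (by cases z <;> simp only [synArr] <;> omega), h.syn]
  outA := fun a b => by
    rw [State.setArr_arr_of_ne _ _ _ (by cases z <;> simp only [outArrA] <;> omega), h.outA]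
  outB := fun a b => by
    rw [State.setArr_arr_of_ne _ _ _ (by cases z <;> simp only [outArrB] <;> omega), h.outB]

theorem Rep.flip_syn (h : Rep z st₀ st s o) (a : Fin nA) (b : Fin nB) :
    Rep z st₀ (st.setArr (synArr z) (cellIdx z nA nB a b)
      (1 - st.arr (synArr z) (cellIdx z nA nB a b))) (s + Pi.single (a, b) 1) o where
  frame := fun m h1 h2 h3 h4 h5 => by
    rw [State.setArr_arr_of_ne _ _ _ h1, h.frame m h1 h2 h3 h4 h5]
  reg_zero := h.reg_zero
  reg_one := h.reg_one
  syn := fun a' b' => by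
    have := cellIdx_inj (z := z) (a', b') (a, b)
    dsimp only at this
    simp only [State.setArr_arr, true_and, this, val_add_single, h.syn]
  outA := fun a b => by
    rw [State.setArr_arr_of_ne _ _ _ (by cases z <;> decide), h.outA]
  outB := fun a b => by
    rw [State.setArr_arr_of_ne _ _ _ (by cases z <;> decide), h.outB]

theorem Rep.flip_outA (h : Rep z st₀ st s o) (a α : Fin nA) :
    Rep z st₀ (st.setArr (outArrA z) (outIdx z nA a α)
      (1 - st.arr (outArrA z) (outIdx z nA a α))) s (o + Pi.single (.inl (a, α)) 1) where
  frame := fun m h1 h2 h3 h4 h5 => by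
    rw [State.setArr_arr_of_ne _ _ _ h2, h.frame m h1 h2 h3 h4 h5]
  reg_zero := h.reg_zero
  reg_one := h.reg_one
  syn := fun a b => by
    rw [State.setArr_arr_of_ne _ _ _ (by cases z <;> decide), h.syn]
  outA := fun a' α' => by
    have := outIdx_inj (z := z) (a', α') (a, α)
    dsimp only at this
    simp only [State.setArr_arr, true_and, this, val_add_single, h.outA, Sum.inl.injEq]
  outB := fun β b => by
    rw [State.setArr_arr_of_ne _ _ _ (by cases z <;> decide), h.outB, val_add_single]
    simp

theorem Rep.flip_outB (h : Rep z st₀ st s o) (β b : Fin nB) :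
    Rep z st₀ (st.setArr (outArrB z) (outIdx z nB β b)
      (1 - st.arr (outArrB z) (outIdx z nB β b))) s (o + Pi.single (.inr (β, b)) 1) where
  frame := fun m h1 h2 h3 h4 h5 => by
    rw [State.setArr_arr_of_ne _ _ _ h3, h.frame m h1 h2 h3 h4 h5]
  reg_zero := h.reg_zero
  reg_one := h.reg_one
  syn := fun a b => by
    rw [State.setArr_arr_of_ne _ _ _ (by cases z <;> decide), h.syn]
  outA := fun a α => by
    rw [State.setArr_arr_of_ne _ _ _ (by cases z <;> decide), h.outA, val_add_single]
    simp
  outB := fun β' b' => by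
    have := outIdx_inj (z := z) (β', b') (β, b)
    dsimp only at this
    simp only [State.setArr_arr, true_and, this, val_add_single, h.outB, Sum.inr.injEq]

variable {ΔA ΔB : ℕ} {ν : Fin nA → Fin ΔA → Fin nB} {μ : Fin nB → Fin ΔB → Fin nA}

theorem Rep.tables (h : Rep z st₀ st s o) (ht : Tables ν μ st₀) : Tables ν μ st := by
  have hz : ∀ m, 7 ≤ m → m ≠ 9 → m ≠ 10 → st.arr m = st₀.arr m := fun m h1 h2 h3 =>
    h.frame m (by cases z <;> simp only [synArr] <;> omega)
      (by cases z <;> simp only [outArrA] <;> omega)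
      (by cases z <;> simp only [outArrB] <;> omega) h2 h3
  constructor
  · rw [hz 7 (by omega) (by omega) (by omega)]; exact ht.mulA
  · rw [hz 8 (by omega) (by omega) (by omega)]; exact ht.mulB
  · intro a j
    rw [hz _ (by unfold SmallSetFlip.nbrA; omega) (by unfold SmallSetFlip.nbrA; omega)
      (by unfold SmallSetFlip.nbrA; omega)]
    exact ht.nbrA a j
  · intro b i
    rw [hz _ (by unfold SmallSetFlip.nbrB; omega) (by unfold SmallSetFlip.nbrB; omega)
      (by unfold SmallSetFlip.nbrB; omega)]
    exact ht.nbrB b i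

end

end SmallSetFlip

/-! ### Flipping qubits and pushing generators in memory -/

namespace SmallSetFlip

open RAM Program BipartiteGraph

/-- The memory while the flips at one generator are tried: `st₁` is the state at the start, when
the syndrome had weight `w`. -/
structure Trying {nA nB : ℕ} (z : Bool) (st₀ st₁ st : State) (w : ℕ)
    (s : Fin nA × Fin nB → ZMod 2) (o : Qubit nA nB → ZMod 2) : Prop where
  rep : Rep z st₀ st s o
  reg : ∀ r, r ≠ 9 → r ≠ 10 → st.reg r = st₁.reg r
  arr_nine : st.arr 9 = st₁.arr 9
  arr_ten : st.arr 10 = st₁.arr 10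
  -- The subtraction-free form of: the change of weight is register `9` minus register `10`.
  count : st.reg 9 + w = st.reg 10 + hammingNorm s

section

variable {nA nB ΔA ΔB : ℕ} {z : Bool} {st₀ st₁ st : State} {w : ℕ}
  {s : Fin nA × Fin nB → ZMod 2} {o : Qubit nA nB → ZMod 2}
  {ν : Fin nA → Fin ΔA → Fin nB} {μ : Fin nB → Fin ΔB → Fin nA} {G : BipartiteGraph nA nB}
  {β : Fin nB} {α : Fin nA}

theorem Tables.eval_rowExpr (ht : Tables ν μ st) (hβ : st.reg 7 = β) (i : Fin ΔB) :
    (rowExpr i).eval st = μ β i := by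
  simp [rowExpr, hβ, ht.nbrB]

theorem Tables.eval_colExpr (ht : Tables ν μ st) (hα : st.reg 8 = α) (j : Fin ΔA) :
    (colExpr j).eval st = ν α j := by
  simp [colExpr, hα, ht.nbrA]

theorem Tables.of_arr (ht : Tables ν μ st) {st' : State} (h : st'.arr = st.arr) :
    Tables ν μ st' := by
  constructor <;> rw [h]
  exacts [ht.mulA, ht.mulB, ht.nbrA, ht.nbrB]

theorem Tables.eval_cellExpr (ht : Tables ν μ st) (hn : nB ≤ nA) {ea eb : Expr} {a : Fin nA}
    {b : Fin nB} (ha : ea.eval st = a) (hb : eb.eval st = b) :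
    (cellExpr z ea eb).eval st = cellIdx z nA nB a b := by
  cases z
  · simp [cellExpr, cellIdx, ha, hb, ht.mulB]
  -- The tables of multiples have `nA` entries; an index below `nB` fits because `nB ≤ nA`.
  · simp [cellExpr, cellIdx, ha, hb, ht.mulA _ (b.2.trans_le hn)]

theorem Tables.eval_outExprA (ht : Tables ν μ st) {ea eb : Expr} {a b : Fin nA}
    (ha : ea.eval st = a) (hb : eb.eval st = b) :
    (outExpr z 7 ea eb).eval st = outIdx z nA a b := by
  cases z <;> simp [outExpr, outIdx, ha, hb, ht.mulA]

theorem Tables.eval_outExprB (ht : Tables ν μ st) (hn : nB ≤ nA) {ea eb : Expr} {a b : Fin nB}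
    (ha : ea.eval st = a) (hb : eb.eval st = b) :
    (outExpr z 8 ea eb).eval st = outIdx z nB a b := by
  cases z
  · simp [outExpr, outIdx, ha, hb, ht.mulB _ (a.2.trans_le hn)]
  · simp [outExpr, outIdx, ha, hb, ht.mulB _ (b.2.trans_le hn)]

theorem synArr_ne (z : Bool) : 9 ≠ synArr z ∧ 10 ≠ synArr z ∧ 9 ≠ outArrA z ∧ 10 ≠ outArrA z ∧
    9 ≠ outArrB z ∧ 10 ≠ outArrB z := by
  cases z <;> decide

theorem Trying.flipCheck (h : Trying z st₀ st₁ st w s o) (ht : Tables ν μ st₀) (hn : nB ≤ nA)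
    (hβ : st₁.reg 7 = β) (hα : st₁.reg 8 = α) (i : Fin ΔB) (j : Fin ΔA) :
    Trying z st₀ st₁ ((SmallSetFlip.flipCheck z (rowExpr i) (colExpr j)).run st) w
      (s + Pi.single (μ β i, ν α j) 1) o := by
  have ht' := h.rep.tables ht
  have hE : ∀ st', st'.arr = st.arr → st'.reg 7 = st.reg 7 → st'.reg 8 = st.reg 8 →
      (cellExpr z (rowExpr i) (colExpr j)).eval st' = cellIdx z nA nB (μ β i) (ν α j) := by
    intro st' h1 h2 h3
    have ht'' := ht'.of_arr h1
    exact ht''.eval_cellExpr hn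
      (ht''.eval_rowExpr (by rw [h2, h.reg 7 (by decide) (by decide), hβ]) i)
      (ht''.eval_colExpr (by rw [h3, h.reg 8 (by decide) (by decide), hα]) j)
  set u := st.arr (synArr z) (cellIdx z nA nB (μ β i) (ν α j)) with hu
  have hrun : (SmallSetFlip.flipCheck z (rowExpr i) (colExpr j)).run st =
      ((st.setReg 10 (st.reg 10 + u)).setReg 9 (st.reg 9 + (1 - u))).setArr (synArr z)
        (cellIdx z nA nB (μ β i) (ν α j)) (1 - u) := by
    simp only [SmallSetFlip.flipCheck, flipBit, run, Expr.eval]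
    rw [hE st rfl rfl rfl, hE (st.setReg 10 _) rfl rfl rfl, hE ((st.setReg 10 _).setReg 9 _) rfl
      rfl rfl]
    rfl
  obtain ⟨n1, n2, -⟩ := synArr_ne z
  rw [hrun]
  refine ⟨?_, ?_, ?_, ?_, ?_⟩
  · exact ((h.rep.setReg 10 _ (by decide) (by decide)).setReg 9 _ (by decide) (by decide)).flip_syn
      (μ β i) (ν α j)
  · intro r h1 h2
    simp [h1, h2, h.reg]
  · rw [State.setArr_arr_of_ne _ _ _ n1]; exact h.arr_nine
  · rw [State.setArr_arr_of_ne _ _ _ n2]; exact h.arr_ten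
  · have h1 := hammingNorm_add_single s (μ β i, ν α j)
    have h2 : u = (s (μ β i, ν α j)).val := h.rep.syn _ _
    have h3 := ZMod.val_lt (s (μ β i, ν α j))
    have h4 := h.count
    rw [← h2] at h1 h3
    simp
    omega

theorem Trying.seqList {ι : Type*} (l : List ι) (f : ι → Program)
    (ds : ι → Fin nA × Fin nB → ZMod 2) (dq : ι → Qubit nA nB → ZMod 2)
    (hf : ∀ i st s o, Trying z st₀ st₁ st w s o →
      Trying z st₀ st₁ ((f i).run st) w (s + ds i) (o + dq i))
    (h : Trying z st₀ st₁ st w s o) :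
    Trying z st₀ st₁ ((Program.seqList (l.map f)).run st) w (s + (l.map ds).sum)
      (o + (l.map dq).sum) := by
  induction l generalizing st s o with
  | nil => simpa using h
  | cons i l ih =>
    have := ih (hf i st s o h)
    simpa [add_assoc] using this

theorem Enumerates.HX_mulVec_inl (he : Enumerates G ν μ) (a α : Fin nA) :
    G.HX.mulVec (Pi.single (.inl (a, α)) 1) = ∑ j, Pi.single (a, ν α j) 1 := by
  rw [HX_mulVec_single_inl, he.nl_eq, Finset.sum_image (he.injA α).injOn]

theorem Enumerates.HX_mulVec_inr (he : Enumerates G ν μ) (β b : Fin nB) :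
    G.HX.mulVec (Pi.single (.inr (β, b)) 1) = ∑ i, Pi.single (μ β i, b) 1 := by
  rw [HX_mulVec_single_inr, he.nr_eq, Finset.sum_image (he.injB β).injOn]

theorem Trying.flipRow (h : Trying z st₀ st₁ st w s o) (he : Enumerates G ν μ)
    (ht : Tables ν μ st₀) (hn : nB ≤ nA) (hβ : st₁.reg 7 = β) (hα : st₁.reg 8 = α) (i : Fin ΔB) :
    Trying z st₀ st₁ ((SmallSetFlip.flipRow z ΔA i).run st) w
      (s + G.HX.mulVec (Pi.single (.inl (μ β i, α)) 1)) (o + Pi.single (.inl (μ β i, α)) 1) := by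
  have h1 := Trying.seqList (List.finRange ΔA)
    (fun j => SmallSetFlip.flipCheck z (rowExpr i) (colExpr j))
    (fun j => Pi.single (μ β i, ν α j) 1) (fun _ => 0)
    (fun j st s o h => by simpa using h.flipCheck ht hn hβ hα i j) h
  rw [← Fin.sum_univ_def, ← Fin.sum_univ_def, ← he.HX_mulVec_inl, Finset.sum_const_zero,
    add_zero] at h1
  have ht' := h1.rep.tables ht
  obtain ⟨-, -, n1, n2, -⟩ := synArr_ne z
  have hE := ht'.eval_outExprA (z := z) (eb := .reg 8) (b := α)
    (ht'.eval_rowExpr (by rw [h1.reg 7 (by decide) (by decide), hβ]) i)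
    (by rw [Expr.eval, h1.reg 8 (by decide) (by decide), hα])
  simp only [SmallSetFlip.flipRow, run, flipBit, Expr.eval, hE]
  refine ⟨h1.rep.flip_outA _ _, h1.reg, ?_, ?_, h1.count⟩
  · rw [State.setArr_arr_of_ne _ _ _ n1]; exact h1.arr_nine
  · rw [State.setArr_arr_of_ne _ _ _ n2]; exact h1.arr_ten

theorem Trying.flipCol (h : Trying z st₀ st₁ st w s o) (he : Enumerates G ν μ)
    (ht : Tables ν μ st₀) (hn : nB ≤ nA) (hβ : st₁.reg 7 = β) (hα : st₁.reg 8 = α) (j : Fin ΔA) :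
    Trying z st₀ st₁ ((SmallSetFlip.flipCol z ΔB j).run st) w
      (s + G.HX.mulVec (Pi.single (.inr (β, ν α j)) 1)) (o + Pi.single (.inr (β, ν α j)) 1) := by
  have h1 := Trying.seqList (List.finRange ΔB)
    (fun i => SmallSetFlip.flipCheck z (rowExpr i) (colExpr j))
    (fun i => Pi.single (μ β i, ν α j) 1) (fun _ => 0)
    (fun i st s o h => by simpa using h.flipCheck ht hn hβ hα i j) h
  rw [← Fin.sum_univ_def, ← Fin.sum_univ_def, ← he.HX_mulVec_inr, Finset.sum_const_zero,
    add_zero] at h1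
  have ht' := h1.rep.tables ht
  obtain ⟨-, -, -, -, n1, n2⟩ := synArr_ne z
  have hE := ht'.eval_outExprB (z := z) (ea := .reg 7) (a := β) hn
    (by rw [Expr.eval, h1.reg 7 (by decide) (by decide), hβ])
    (ht'.eval_colExpr (by rw [h1.reg 8 (by decide) (by decide), hα]) j)
  simp only [SmallSetFlip.flipCol, run, flipBit, Expr.eval, hE]
  refine ⟨h1.rep.flip_outB _ _, h1.reg, ?_, ?_, h1.count⟩
  · rw [State.setArr_arr_of_ne _ _ _ n1]; exact h1.arr_nine
  · rw [State.setArr_arr_of_ne _ _ _ n2]; exact h1.arr_ten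

theorem flipVec_eq_sum (β : Fin nB) (α : Fin nA) (x : Finset (Fin nA)) (y : Finset (Fin nB)) :
    flipVec β α x y = ∑ a ∈ x, Pi.single (.inl (a, α)) 1 + ∑ b ∈ y, Pi.single (.inr (β, b)) 1 := by
  funext q
  rw [Pi.add_apply, Finset.sum_apply, Finset.sum_apply]
  rcases q with ⟨a, a'⟩ | ⟨b, b'⟩
  · by_cases h : a' = α <;> simp [flipVec, Pi.single_apply, h]
  · by_cases h : b = β <;> simp [flipVec, Pi.single_apply, h]

/-- The indicator vector of a set of qubits of a generator. -/
def slotVec (ν : Fin nA → Fin ΔA → Fin nB) (μ : Fin nB → Fin ΔB → Fin nA) (β : Fin nB)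
    (α : Fin nA) (X : Finset (Fin ΔB)) (Y : Finset (Fin ΔA)) : Qubit nA nB → ZMod 2 :=
  flipVec β α (X.image (μ β)) (Y.image (ν α))

theorem Trying.flipSet (h : Trying z st₀ st₁ st w s o) (he : Enumerates G ν μ)
    (ht : Tables ν μ st₀) (hn : nB ≤ nA) (hβ : st₁.reg 7 = β) (hα : st₁.reg 8 = α)
    (X : Finset (Fin ΔB)) (Y : Finset (Fin ΔA)) :
    Trying z st₀ st₁ ((SmallSetFlip.flipSet z X Y).run st) w
      (s + G.HX.mulVec (slotVec ν μ β α X Y)) (o + slotVec ν μ β α X Y) := by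
  have h1 := Trying.seqList X.toList (fun i => SmallSetFlip.flipRow z ΔA i) _ _
    (fun i st s o h => h.flipRow he ht hn hβ hα i) h
  have h2 := Trying.seqList Y.toList (fun j => SmallSetFlip.flipCol z ΔB j) _ _
    (fun j st s o h => h.flipCol he ht hn hβ hα j) h1
  simp only [Finset.sum_map_toList] at h2
  have hv : slotVec ν μ β α X Y = ∑ i ∈ X, Pi.single (.inl (μ β i, α)) 1 +
      ∑ j ∈ Y, Pi.single (.inr (β, ν α j)) 1 := by
    rw [slotVec, flipVec_eq_sum, Finset.sum_image (he.injB β).injOn,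
      Finset.sum_image (he.injA α).injOn]
  rw [hv, Matrix.mulVec_add, ← add_assoc, ← add_assoc, ← Matrix.mulVecLin_apply, map_sum,
    ← Matrix.mulVecLin_apply, map_sum]
  exact h2

/-- All entries of the stack are generators. -/
def StackValid (nA nB : ℕ) (st : State) : Prop :=
  ∀ k < st.reg 6, st.arr 9 k < nB ∧ st.arr 10 k < nA

/-- The generator `(b, a)` is on the stack. -/
def OnStack (st : State) (b a : ℕ) : Prop :=
  ∃ k < st.reg 6, st.arr 9 k = b ∧ st.arr 10 k = a

/-- The second expression is evaluated after array `9` has been written, so its value is required to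
be independent of that write. -/
theorem stack_push {eb ea : Expr} (b a : ℕ) (hb : eb.eval st = b)
    (ha : ∀ v, ea.eval (st.setArr 9 (st.reg 6) v) = a) :
    ((push eb ea).run st).reg 6 = st.reg 6 + 1 ∧ OnStack ((push eb ea).run st) b a ∧
    (∀ b' a', OnStack st b' a' → OnStack ((push eb ea).run st) b' a') ∧
    (b < nB → a < nA → StackValid nA nB st → StackValid nA nB ((push eb ea).run st)) := by
  have hrun : (push eb ea).run st =
      ((st.setArr 9 (st.reg 6) b).setArr 10 (st.reg 6) a).setReg 6 (st.reg 6 + 1) := by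
    simp only [push, run, Expr.eval, hb, ha]
    rfl
  rw [hrun]
  refine ⟨by simp, ⟨st.reg 6, by simp, by simp [State.setArr_arr], by simp [State.setArr_arr]⟩, ?_, ?_⟩
  · rintro b' a' ⟨k, hk, h1, h2⟩
    refine ⟨k, by simp; omega, ?_, ?_⟩ <;> simp [State.setArr_arr, hk.ne, h1, h2]
  · intro hb ha hv k hk
    simp only [State.setReg_reg, if_true] at hk
    by_cases h : k = st.reg 6
    · simp [State.setArr_arr, h, hb, ha]
    · have := hv k (by omega)
      simpa [State.setArr_arr, h] using this

theorem Rep.push (h : Rep z st₀ st s o) (eb ea : Expr) :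
    Rep z st₀ ((SmallSetFlip.push eb ea).run st) s o :=
  ((h.setArr_stack 9 _ _ (.inl rfl)).setArr_stack 10 _ _ (.inr rfl)).setReg 6 _ (by decide)
    (by decide)

theorem reg_push (eb ea : Expr) (r : ℕ) (hr : r ≠ 6) :
    ((push eb ea).run st).reg r = st.reg r := by
  simp [push, run, hr]

theorem pushNear_spec (ht : Tables ν μ st₀) (h : Rep z st₀ st s o) (hβ : st.reg 7 = β)
    (hα : st.reg 8 = α) (hv : StackValid nA nB st) :
    Rep z st₀ ((pushNear ΔA ΔB).run st) s o ∧
    ((pushNear ΔA ΔB).run st).reg 6 = st.reg 6 + (ΔB * ΔA) * (ΔA * ΔB) ∧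
    StackValid nA nB ((pushNear ΔA ΔB).run st) ∧
    (∀ b' a', OnStack st b' a' → OnStack ((pushNear ΔA ΔB).run st) b' a') ∧
    ∀ i i' j j', OnStack ((pushNear ΔA ΔB).run st) (ν (μ β i) i') (μ (ν α j) j') := by
  have key : ∀ (l : List ((Fin ΔB × Fin ΔA) × (Fin ΔA × Fin ΔB))) (st : State),
      Rep z st₀ st s o → st.reg 7 = β → st.reg 8 = α → StackValid nA nB st →
      let st' := (seqList (l.map fun q => push (.get (nbrA q.1.2) (rowExpr q.1.1))
        (.get (nbrB q.2.2) (colExpr q.2.1)))).run st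
      Rep z st₀ st' s o ∧ st'.reg 6 = st.reg 6 + l.length ∧ StackValid nA nB st' ∧
      (∀ b' a', OnStack st b' a' → OnStack st' b' a') ∧
      ∀ q ∈ l, OnStack st' (ν (μ β q.1.1) q.1.2) (μ (ν α q.2.1) q.2.2) := by
    intro l
    induction l with
    | nil => intro st h hβ hα hv; exact ⟨h, rfl, hv, fun _ _ h => h, by simp⟩
    | cons q l ih =>
      intro st h hβ hα hv
      have ht' := h.tables ht
      obtain ⟨p1, p2, p3, p4⟩ := stack_push (nA := nA) (nB := nB) (st := st)
        (eb := .get (nbrA q.1.2) (rowExpr q.1.1)) (ea := .get (nbrB q.2.2) (colExpr q.2.1))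
        (ν (μ β q.1.1) q.1.2) (μ (ν α q.2.1) q.2.2)
        (by rw [Expr.eval, ht'.eval_rowExpr hβ, ht'.nbrA])
        (fun v => by
          have ht'' := (h.setArr_stack 9 (st.reg 6) v (.inl rfl)).tables ht
          rw [Expr.eval, ht''.eval_colExpr hα, ht''.nbrB])
      obtain ⟨i1, i2, i3, i4, i5⟩ := ih _ (h.push (.get (nbrA q.1.2) (rowExpr q.1.1))
        (.get (nbrB q.2.2) (colExpr q.2.1)))
        (by rw [reg_push _ _ _ (by decide), hβ])
        (by rw [reg_push _ _ _ (by decide), hα]) (p4 (Fin.is_lt _) (Fin.is_lt _) hv)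
      refine ⟨i1, ?_, i3, fun b' a' hs => i4 _ _ (p3 _ _ hs), ?_⟩
      · rw [List.length_cons, ← add_assoc, add_right_comm, ← p1]; exact i2
      · intro q' hq'
        rcases List.mem_cons.1 hq' with rfl | hq'
        · exact i4 _ _ p2
        · exact i5 _ hq'
  obtain ⟨i1, i2, i3, i4, i5⟩ := key _ st h hβ hα hv
  refine ⟨i1, ?_, i3, i4, fun i i' j j' => i5 ((i, i'), (j, j')) ?_⟩
  · refine i2.trans ?_
    simp [List.length_product]
  · simp

end

end SmallSetFlip

/-! ### The main loop -/

namespace SmallSetFlip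

open RAM Program BipartiteGraph

theorem add_self_eq_zero_of_zmod {ι : Type*} (f : ι → ZMod 2) : f + f = 0 :=
  funext fun i => CharTwo.add_self_eq_zero (f i)

/-- No flip at the generator `(β, α)` is good. -/
def Stuck {nA nB : ℕ} (G : BipartiteGraph nA nB) (s : Fin nA × Fin nB → ZMod 2) (β : Fin nB)
    (α : Fin nA) : Prop :=
  ∀ x y, x ⊆ G.nr β → y ⊆ G.nl α → ¬ G.IsGoodFlip s β α x y

section

variable {nA nB ΔA ΔB : ℕ} {z : Bool} {st₀ st₁ st : State} {w : ℕ}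
  {s : Fin nA × Fin nB → ZMod 2} {o : Qubit nA nB → ZMod 2}
  {ν : Fin nA → Fin ΔA → Fin nB} {μ : Fin nB → Fin ΔB → Fin nA} {G : BipartiteGraph nA nB}
  {β : Fin nB} {α : Fin nA}

theorem tryFlips_spec (he : Enumerates G ν μ) (ht : Tables ν μ st₀) (hn : nB ≤ nA)
    (l : List (Finset (Fin ΔB) × Finset (Fin ΔA))) (hl : ∀ XY ∈ l, 1 ≤ XY.1.card + XY.2.card)
    (st : State) (h : Rep z st₀ st s o) (hβ : st.reg 7 = β) (hα : st.reg 8 = α)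
    (hv : StackValid nA nB st) :
    (Rep z st₀ ((tryFlips z l).run st) s o ∧ ((tryFlips z l).run st).reg 6 = st.reg 6 ∧
      ((tryFlips z l).run st).arr 9 = st.arr 9 ∧ ((tryFlips z l).run st).arr 10 = st.arr 10 ∧
      ∀ XY ∈ l, ¬ G.IsGoodFlip s β α (XY.1.image (μ β)) (XY.2.image (ν α))) ∨
    (∃ XY ∈ l, G.IsGoodFlip s β α (XY.1.image (μ β)) (XY.2.image (ν α)) ∧
      Rep z st₀ ((tryFlips z l).run st) (s + G.HX.mulVec (slotVec ν μ β α XY.1 XY.2))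
        (o + slotVec ν μ β α XY.1 XY.2) ∧
      ((tryFlips z l).run st).reg 6 = st.reg 6 + (ΔB * ΔA) * (ΔA * ΔB) ∧
      StackValid nA nB ((tryFlips z l).run st) ∧
      (∀ b' a', OnStack st b' a' → OnStack ((tryFlips z l).run st) b' a') ∧
      ∀ i i' j j', OnStack ((tryFlips z l).run st) (ν (μ β i) i') (μ (ν α j) j')) := by
  induction l generalizing st with
  | nil => exact .inl ⟨h, rfl, rfl, rfl, by simp⟩
  | cons XY l ih =>
    set st₁ := (st.setReg 9 0).setReg 10 0 with hst₁
    have hβ₁ : st₁.reg 7 = β := by simp [hst₁, hβ]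
    have hα₁ : st₁.reg 8 = α := by simp [hst₁, hα]
    have t1 : Trying z st₀ st₁ st₁ (hammingNorm s) s o :=
      ⟨(h.setReg 9 0 (by decide) (by decide)).setReg 10 0 (by decide) (by decide),
        fun _ _ _ => rfl, rfl, rfl, by simp [hst₁]⟩
    have t2 := t1.flipSet he ht hn hβ₁ hα₁ XY.1 XY.2
    set st₂ := (flipSet z XY.1 XY.2).run st₁ with hst₂
    have r2 : ∀ r, r ≠ 9 → r ≠ 10 → st₂.reg r = st.reg r := fun r h9 h10 => by
      rw [t2.reg r h9 h10]; simp [hst₁, h9, h10]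
    have hgood : G.IsGoodFlip s β α (XY.1.image (μ β)) (XY.2.image (ν α)) ↔
        st₂.reg 9 + (st₂.reg 9 + st₂.reg 9) + (XY.1.card + XY.2.card) -
          (st₂.reg 10 + (st₂.reg 10 + st₂.reg 10)) = 0 := by
      have h1 := t2.count
      have h2 := hl XY (by simp)
      rw [IsGoodFlip, Finset.card_image_of_injective _ (he.injB β),
        Finset.card_image_of_injective _ (he.injA α)]
      rw [slotVec] at h1
      omega
    by_cases hg : G.IsGoodFlip s β α (XY.1.image (μ β)) (XY.2.image (ν α))
    · have hrun : (tryFlips z (XY :: l)).run st = (pushNear ΔA ΔB).run st₂ := by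
        simp only [tryFlips, run, Expr.eval, ← hst₁, ← hst₂, if_pos (hgood.1 hg)]
      rw [hrun]
      have hv₂ : StackValid nA nB st₂ := by
        intro k hk
        rw [t2.arr_nine, t2.arr_ten]
        rw [r2 6 (by decide) (by decide)] at hk
        exact hv k hk
      obtain ⟨p1, p2, p3, p4, p5⟩ := pushNear_spec ht t2.rep
        (by rw [r2 7 (by decide) (by decide), hβ])
        (by rw [r2 8 (by decide) (by decide), hα]) hv₂
      refine .inr ⟨XY, by simp, hg, p1, by rw [p2, r2 6 (by decide) (by decide)], p3, ?_, p5⟩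
      rintro b' a' ⟨k, hk, h1, h2⟩
      exact p4 _ _ ⟨k, by rwa [r2 6 (by decide) (by decide)], by rw [t2.arr_nine]; exact h1,
        by rw [t2.arr_ten]; exact h2⟩
    · have t3 := t2.flipSet he ht hn hβ₁ hα₁ XY.1 XY.2
      -- In characteristic 2 the repeated flip restores both syndrome and output.
      rw [add_assoc, add_self_eq_zero_of_zmod, add_zero, add_assoc, add_self_eq_zero_of_zmod,
        add_zero] at t3
      set st₃ := (flipSet z XY.1 XY.2).run st₂ with hst₃
      have r3 : ∀ r, r ≠ 9 → r ≠ 10 → st₃.reg r = st.reg r := fun r h9 h10 => by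
        rw [t3.reg r h9 h10]; simp [hst₁, h9, h10]
      have hrun : (tryFlips z (XY :: l)).run st = (tryFlips z l).run st₃ := by
        simp only [tryFlips, run, Expr.eval, ← hst₁, ← hst₂, ← hst₃,
          if_neg (fun h => hg (hgood.2 h))]
      have e6 := r3 6 (by decide) (by decide)
      have e9 : st₃.arr 9 = st.arr 9 := t3.arr_nine
      have e10 : st₃.arr 10 = st.arr 10 := t3.arr_ten
      have hv₃ : StackValid nA nB st₃ := by
        intro k hk
        rw [e9, e10]
        rw [e6] at hk
        exact hv k hk
      rw [hrun]
      rcases ih (fun XY h => hl XY (by simp [h])) st₃ t3.rep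
        (by rw [r3 7 (by decide) (by decide), hβ])
        (by rw [r3 8 (by decide) (by decide), hα]) hv₃ with
        ⟨i1, i2, i3, i4, i5⟩ | ⟨XY', i1, i2, i3, i4, i5, i6, i7⟩
      · refine .inl ⟨i1, i2.trans e6, i3.trans e9, i4.trans e10, ?_⟩
        intro XY' hXY'
        rcases List.mem_cons.1 hXY' with rfl | hXY'
        · exact hg
        · exact i5 _ hXY'
      · refine .inr ⟨XY', by simp [i1], i2, i3, by rw [i4, e6], i5, ?_, i7⟩
        rintro b' a' ⟨k, hk, h1, h2⟩
        exact i6 _ _ ⟨k, by rwa [e6], by rw [e9]; exact h1, by rw [e10]; exact h2⟩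

theorem stuck_of_slots (he : Enumerates G ν μ)
    (h : ∀ XY ∈ allFlips ΔA ΔB, ¬ G.IsGoodFlip s β α (XY.1.image (μ β)) (XY.2.image (ν α))) :
    Stuck G s β α := by
  classical
  intro x y hx hy hg
  rw [he.nr_eq] at hx
  rw [he.nl_eq] at hy
  obtain ⟨X, -, rfl⟩ := Finset.subset_image_iff.1 hx
  obtain ⟨Y, -, rfl⟩ := Finset.subset_image_iff.1 hy
  refine h (X, Y) ?_ hg
  have := hg.1
  rw [Finset.card_image_of_injective _ (he.injB β),
    Finset.card_image_of_injective _ (he.injA α)] at this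
  simpa [allFlips] using this

theorem hammingNorm_slotVec_le (X : Finset (Fin ΔB))
    (Y : Finset (Fin ΔA)) :
    hammingNorm (slotVec ν μ β α X Y) ≤
      (X.image (μ β)).card + (Y.image (ν α)).card := by
  rw [slotVec, flipVec_eq_sum]
  refine (hammingNorm_add_le _ _).trans (add_le_add ?_ ?_) <;>
    refine (hammingNorm_sum_le _ _).trans ?_ <;> simp [hammingNorm_single_one]

/-- The invariant of the main loop; `m` is the variant. -/
def LoopInv (G : BipartiteGraph nA nB) (ΔA ΔB : ℕ) (z : Bool) (st₀ : State)
    (s₀ : Fin nA × Fin nB → ZMod 2) (m : ℕ) (st : State) : Prop :=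
  ∃ s o, Rep z st₀ st s o ∧ StackValid nA nB st ∧
    (∀ (β : Fin nB) (α : Fin nA), OnStack st β α ∨ Stuck G s β α) ∧
    s = s₀ + G.HX.mulVec o ∧ 3 * hammingNorm s + hammingNorm o ≤ 3 * hammingNorm s₀ ∧
    -- The factor is the number of entries pushed after a good flip, so the drop in syndrome weight
    -- pays for them and the pop makes the decrease strict.
    m = (ΔB * ΔA) * (ΔA * ΔB) * hammingNorm s + st.reg 6

/-- A flip changes the syndrome only on its own grid, and whether a generator is stuck depends only
on the syndrome on that generator's grid. Grids with no common row or no common column are disjoint.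
-/
theorem stuck_add_of_far (X : Finset (Fin ΔB)) (Y : Finset (Fin ΔA)) (he : Enumerates G ν μ)
    {β' : Fin nB} {α' : Fin nA} (h : Stuck G s β' α')
    (hfar : ¬ ((∃ i, μ β i ∈ G.nr β') ∧ ∃ j, ν α j ∈ G.nl α')) :
    Stuck G (s + G.HX.mulVec (slotVec ν μ β α X Y)) β' α' := by
  classical
  intro x y hx hy hg
  refine h x y hx hy (hg.congr _ hx hy fun a ha b hb => ?_)
  have h0 : G.HX.mulVec (slotVec ν μ β α X Y) (a, b) = 0 := by
    have key : ¬ (a ∈ G.nr β ∧ b ∈ G.nl α) := by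
      rintro ⟨h1, h2⟩
      rw [he.nr_eq] at h1
      rw [he.nl_eq] at h2
      obtain ⟨i, -, rfl⟩ := Finset.mem_image.1 h1
      obtain ⟨j, -, rfl⟩ := Finset.mem_image.1 h2
      exact hfar ⟨⟨i, ha⟩, ⟨j, hb⟩⟩
    have hX : X.image (μ β) ⊆ G.nr β := by
      rw [he.nr_eq]; exact Finset.image_subset_image (Finset.subset_univ _)
    have hY : Y.image (ν α) ⊆ G.nl α := by
      rw [he.nl_eq]; exact Finset.image_subset_image (Finset.subset_univ _)
    rw [slotVec, HX_mulVec_flipVec]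
    simp only [if_neg fun h : a ∈ X.image (μ β) ∧ b ∈ G.nl α => key ⟨hX h.1, h.2⟩,
      if_neg fun h : b ∈ Y.image (ν α) ∧ a ∈ G.nr β => key ⟨h.2, hY h.1⟩, add_zero]
  rw [Pi.add_apply, h0, add_zero]

theorem LoopInv.round {s₀ : Fin nA × Fin nB → ZMod 2} (hΔA : 0 < ΔA) (hΔB : 0 < ΔB)
    (he : Enumerates G ν μ) (ht : Tables ν μ st₀) (hn : nB ≤ nA) (m : ℕ) (st : State)
    (h : LoopInv G ΔA ΔB z st₀ s₀ m st) (hsp : st.reg 6 ≠ 0) :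
    ∃ m' < m, LoopInv G ΔA ΔB z st₀ s₀ m' ((SmallSetFlip.round z ΔA ΔB).run st) := by
  classical
  obtain ⟨s, o, hr, hv, hst, hs, hw, hm⟩ := h
  obtain ⟨hb, ha⟩ := hv (st.reg 6 - 1) (by omega)
  set β : Fin nB := ⟨_, hb⟩ with hβ
  set α : Fin nA := ⟨_, ha⟩ with hα
  set st₁ := ((st.setReg 6 (st.reg 6 - 1)).setReg 7 β).setReg 8 α with hst₁
  have hrun : (SmallSetFlip.round z ΔA ΔB).run st =
      (tryFlips z (allFlips ΔA ΔB)).run st₁ := by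
    simp [SmallSetFlip.round, run, hst₁, hβ, hα]
  have r1 : Rep z st₀ st₁ s o := ((hr.setReg 6 _ (by decide) (by decide)).setReg 7 _ (by decide)
    (by decide)).setReg 8 _ (by decide) (by decide)
  have e6 : st₁.reg 6 = st.reg 6 - 1 := by simp [hst₁]
  have hv₁ : StackValid nA nB st₁ := fun k hk => hv k (by omega)
  have hon : ∀ (β' : Fin nB) (α' : Fin nA), OnStack st β' α' →
      (β' = β ∧ α' = α) ∨ OnStack st₁ β' α' := by
    rintro β' α' ⟨k, hk, h1, h2⟩
    by_cases hk' : k = st.reg 6 - 1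
    · subst hk'
      exact .inl ⟨Fin.ext h1.symm, Fin.ext h2.symm⟩
    · exact .inr ⟨k, by omega, h1, h2⟩
  rw [hrun]
  rcases tryFlips_spec (β := β) (α := α) he ht hn (allFlips ΔA ΔB) (by simp [allFlips]) st₁ r1
    (by simp [hst₁]) (by simp [hst₁]) hv₁ with
    ⟨i1, i2, i3, i4, i5⟩ | ⟨XY, -, i2, i3, i4, i5, i6, i7⟩
  · refine ⟨_, ?_, s, o, i1, ?_, ?_, hs, hw, rfl⟩
    · rw [i2, e6]; omega
    · intro k hk
      rw [i3, i4]
      exact hv₁ k (by rwa [i2] at hk)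
    · intro β' α'
      rcases hst β' α' with hβα | hβα
      · rcases hon _ _ hβα with ⟨rfl, rfl⟩ | ⟨k, hk, h1, h2⟩
        · exact .inr (stuck_of_slots he i5)
        · exact .inl ⟨k, by rwa [i2], by rwa [i3], by rwa [i4]⟩
      · exact .inr hβα
  · have hlt := i2.2
    have hone := i2.1
    have hvn := hammingNorm_slotVec_le (ν := ν) (μ := μ) (β := β) (α := α) XY.1 XY.2
    have hvn' := hammingNorm_add_le o (slotVec ν μ β α XY.1 XY.2)
    refine ⟨_, ?_, _, _, i3, i5, ?_, ?_, ?_, rfl⟩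
    · rw [i4, e6, hm]
      -- At least one qubit is flipped, so three times the drop is positive.
      have hlt' : hammingNorm (s + G.HX.mulVec (slotVec ν μ β α XY.1 XY.2)) + 1 ≤
          hammingNorm s := by
        rw [slotVec]; omega
      have := Nat.mul_le_mul_left ((ΔB * ΔA) * (ΔA * ΔB)) hlt'
      rw [mul_add] at this
      omega
    · intro β' α'
      by_cases hnear : (∃ i, μ β i ∈ G.nr β') ∧ ∃ j, ν α j ∈ G.nl α'
      · obtain ⟨⟨i, hi⟩, ⟨j, hj⟩⟩ := hnear
        have hi' : β' ∈ G.nl (μ β i) := mem_nl.2 (mem_nr.1 hi)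
        have hj' : α' ∈ G.nr (ν α j) := mem_nr.2 (mem_nl.1 hj)
        rw [he.nl_eq] at hi'
        rw [he.nr_eq] at hj'
        obtain ⟨i', -, rfl⟩ := Finset.mem_image.1 hi'
        obtain ⟨j', -, rfl⟩ := Finset.mem_image.1 hj'
        exact .inl (i7 i i' j j')
      · rcases hst β' α' with hβα | hβα
        · rcases hon _ _ hβα with ⟨rfl, rfl⟩ | hs
          -- The popped generator shares checks with itself, as the degrees are positive; so it has
          -- been pushed again.
          · refine absurd ⟨⟨⟨0, hΔB⟩, ?_⟩, ⟨⟨0, hΔA⟩, ?_⟩⟩ hnear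
            · rw [he.nr_eq]; exact Finset.mem_image_of_mem _ (Finset.mem_univ _)
            · rw [he.nl_eq]; exact Finset.mem_image_of_mem _ (Finset.mem_univ _)
          · exact .inl (i6 _ _ hs)
        · exact .inr (stuck_add_of_far _ _ he hβα hnear)
    · rw [hs, Matrix.mulVec_add, add_assoc]
    · rw [slotVec] at *
      omega

theorem fill_runs (z : Bool) (st₀ st : State) (s : Fin nA × Fin nB → ZMod 2)
    (o : Qubit nA nB → ZMod 2) (h : Rep z st₀ st s o) (h6 : st.reg 6 = 0) :
    (forLoop₂ (push (.reg 2) (.reg 3))).Runs st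
      (nB * (nA * ((push (.reg 2) (.reg 3)).timeBound + 8) + 6 + 8) + 6) fun st' =>
        Rep z st₀ st' s o ∧ StackValid nA nB st' ∧
        (∀ (β : Fin nB) (α : Fin nA), OnStack st' β α) ∧ st'.reg 6 = nB * nA := by
  refine (Runs.forLoop₂ nA nB (fun k l st' => Rep z st₀ st' s o ∧
    (k ≤ nB → StackValid nA nB st') ∧
    (∀ (β : Fin nB) (α : Fin nA), ((β : ℕ) < k ∨ (β : ℕ) = k ∧ (α : ℕ) < l) → OnStack st' β α) ∧
    st'.reg 6 = k * nA + l) ?_ ?_ ?_ ?_ st ?_ h.reg_zero h.reg_one).mono le_rfl ?_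
  · rintro k l s v ⟨h1, h2, h3, h4⟩
    exact ⟨h1.setReg 2 v (by decide) (by decide), h2, h3, h4⟩
  · rintro k l s v ⟨h1, h2, h3, h4⟩
    exact ⟨h1.setReg 3 v (by decide) (by decide), h2, h3, h4⟩
  · rintro k s ⟨h1, h2, h3, h4⟩
    refine ⟨h1, fun hk => h2 (by omega), fun β α hlt => h3 β α ?_, by rw [h4]; ring⟩
    have := α.2
    omega
  · rintro k hk l hl s' ⟨h1, h2, h3, h4⟩ r0 r1 r2 r3
    refine (loopFree_push _ _).runs_of ?_
    obtain ⟨p1, p2, p3, p4⟩ := stack_push (nA := nA) (nB := nB) (st := s') (eb := .reg 2)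
      (ea := .reg 3) k l r2 (fun v => r3)
    refine ⟨⟨h1.push _ _, fun _ => p4 hk hl (h2 hk.le), ?_, by rw [p1, h4]; ring⟩, ?_⟩
    · intro β α hlt
      by_cases hc : (β : ℕ) = k ∧ (α : ℕ) = l
      · rw [hc.1, hc.2]; exact p2
      · exact p3 _ _ (h3 β α (by omega))
    · simp only [reg_push _ _ _ (by decide : (0 : ℕ) ≠ 6),
        reg_push _ _ _ (by decide : (1 : ℕ) ≠ 6), reg_push _ _ _ (by decide : (2 : ℕ) ≠ 6),
        reg_push _ _ _ (by decide : (3 : ℕ) ≠ 6), r0, r1, r2, r3, and_self]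
  · exact ⟨h, fun _ k hk => by omega, fun β α hlt => by omega, by omega⟩
  · rintro s' ⟨⟨h1, h2, h3, h4⟩, -⟩
    exact ⟨h1, h2 le_rfl, fun β α => h3 β α (.inl β.2), h4⟩

/-- The variant starts below a constant times `nA * nB`, because any syndrome has weight at most `nA
* nB`. Once the stack is empty, the invariant leaves only stuck generators. -/
theorem phase_runs {s₀ : Fin nA × Fin nB → ZMod 2} (hΔA : 0 < ΔA) (hΔB : 0 < ΔB)
    (he : Enumerates G ν μ) (ht : Tables ν μ st₀) (hn : nB ≤ nA)
    (h : Rep z st₀ st₀ s₀ (0 : Qubit nA nB → ZMod 2)) :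
    (phase z ΔA ΔB).Runs st₀
      (2 + ((nB * (nA * ((push (.reg 2) (.reg 3)).timeBound + 8) + 6 + 8) + 6) +
        (((ΔB * ΔA) * (ΔA * ΔB) * (nA * nB) + nB * nA) *
          (2 + (round z ΔA ΔB).timeBound) + 2))) fun st' =>
      ∃ s o, Rep z st₀ st' s o ∧ s = s₀ + G.HX.mulVec o ∧
        3 * hammingNorm s + hammingNorm o ≤ 3 * hammingNorm s₀ ∧ ∀ β α, Stuck G s β α := by
  have h1 : (Program.assign 6 (.lit 0)).Runs st₀ 2 fun st' => st' = st₀.setReg 6 0 :=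
    ⟨_, _, .assign 6 _ _, le_rfl, rfl⟩
  refine h1.seq fun st' hst' => ?_
  subst hst'
  refine (fill_runs z st₀ _ s₀ 0 (h.setReg 6 0 (by decide) (by decide)) (by simp)).seq ?_
  rintro st ⟨r, hv, hon, h6⟩
  refine (Runs.loop (LoopInv G ΔA ΔB z st₀ s₀) (T := (round z ΔA ΔB).timeBound) ?_
    ((ΔB * ΔA) * (ΔA * ΔB) * hammingNorm s₀ + nB * nA) st ?_).mono ?_ ?_
  · intro m s hs hne
    exact (loopFree_round z ΔA ΔB).runs_of (hs.round hΔA hΔB he ht hn m s hne)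
  · exact ⟨s₀, 0, r, hv, fun β α => .inl (hon β α), by simp, by simp, by rw [h6]⟩
  · have : hammingNorm s₀ ≤ nA * nB := by
      simpa using hammingNorm_le_card_fintype (x := s₀)
    simp only [Expr.cost]
    gcongr
  · rintro s' ⟨h0, m, s, o, h1, h2, h3, h4, h5, h6⟩
    refine ⟨s, o, h1, h4, h5, fun β α => (h3 β α).resolve_left ?_⟩
    rintro ⟨k, hk, -⟩
    simp only [Expr.eval] at h0
    omega

end

end SmallSetFlip

namespace SmallSetFlip

open RAM Program BipartiteGraph

/-! ### Preprocessing -/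

/-- Store the multiples in registers `4`, `5` and proceed to the next ones. -/
def storeMultiples : Program :=
  .seq (.put 7 (.reg 2) (.reg 4)) (.seq (.put 8 (.reg 2) (.reg 5))
    (.seq (.assign 4 (.add (.reg 4) (.reg 0))) (.assign 5 (.add (.reg 5) (.reg 1)))))

/-- Fill the arrays `7` and `8` with the multiples of `nA` and of `nB`. -/
def buildMultiples : Program := forLoop 2 0 storeMultiples

/-- Shift the first `d` entries of the list at index `r` of a family of arrays by one place. -/
def shiftList (arr : ℕ → ℕ) (r : ℕ) : ℕ → Program
  | 0 => .skip
  -- The last entry moves first, so nothing is overwritten before it has been copied.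
  | d + 1 => .seq (.put (arr (d + 1)) (.reg r) (.get (arr d) (.reg r))) (shiftList arr r d)

/-- Insert the content of register `v` in front of the list at index `r`. -/
def insertList (arr : ℕ → ℕ) (D r v : ℕ) : Program :=
  .seq (shiftList arr r D) (.put (arr 0) (.reg r) (.reg v))

/-- Enter the pair in the registers `2`, `3` in the lists of neighbours, if it is an edge. -/
def scanPair (ΔA ΔB : ℕ) : Program :=
  .cond (.get 0 (.add (.get 7 (.reg 2)) (.reg 3)))
    (.seq (insertList nbrA ΔA 3 2) (insertList nbrB ΔB 2 3)) .skip

/-- The complete decoder. -/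
noncomputable def decoder (ΔA ΔB : ℕ) : Program :=
  .seq buildMultiples (.seq (forLoop₂ (scanPair ΔA ΔB))
    (.seq (phase false ΔA ΔB) (phase true ΔA ΔB)))

theorem loopFree_insertList (arr : ℕ → ℕ) (D r v : ℕ) : (insertList arr D r v).LoopFree := by
  refine ⟨?_, trivial⟩
  induction D with
  | zero => trivial
  | succ d ih => exact ⟨trivial, ih⟩

theorem loopFree_scanPair (ΔA ΔB : ℕ) : (scanPair ΔA ΔB).LoopFree :=
  ⟨⟨loopFree_insertList _ _ _ _, loopFree_insertList _ _ _ _⟩, trivial⟩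

theorem run_shiftList (arr : ℕ → ℕ) (harr : Function.Injective arr) (r d : ℕ) (st : State) :
    ((shiftList arr r d).run st).reg = st.reg ∧
    (∀ m, (∀ j, m ≠ arr j) → ((shiftList arr r d).run st).arr m = st.arr m) ∧
    ∀ j i, ((shiftList arr r d).run st).arr (arr j) i =
      if i = st.reg r ∧ 1 ≤ j ∧ j ≤ d then st.arr (arr (j - 1)) i else st.arr (arr j) i := by
  induction d generalizing st with
  | zero =>
    refine ⟨rfl, fun _ _ => rfl, fun j i => ?_⟩
    rw [if_neg (by omega)]
    rfl
  | succ d ih =>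
    obtain ⟨h1, h2, h3⟩ := ih (st.setArr (arr (d + 1)) (st.reg r) (st.arr (arr d) (st.reg r)))
    refine ⟨h1, fun m hm => ?_, fun j i => ?_⟩
    · exact (h2 m hm).trans (State.setArr_arr_of_ne _ _ _ (hm _))
    · refine (h3 j i).trans ?_
      simp only [State.setArr_arr, State.setArr_reg, harr.eq_iff]
      by_cases hi : i = st.reg r
      · by_cases hj : j = d + 1
        · subst hj; simp [hi]
        · by_cases hj' : 1 ≤ j ∧ j ≤ d
          · rw [if_pos ⟨hi, hj'⟩, if_neg (by omega), if_pos ⟨hi, by omega⟩]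
          · rw [if_neg (by omega), if_neg (by omega), if_neg (by omega)]
      · simp [hi]

theorem run_insertList (arr : ℕ → ℕ) (harr : Function.Injective arr) (D r v : ℕ) (st : State) :
    ((insertList arr D r v).run st).reg = st.reg ∧
    (∀ m, (∀ j, m ≠ arr j) → ((insertList arr D r v).run st).arr m = st.arr m) ∧
    (∀ j i, i ≠ st.reg r → ((insertList arr D r v).run st).arr (arr j) i = st.arr (arr j) i) ∧
    ((insertList arr D r v).run st).arr (arr 0) (st.reg r) = st.reg v ∧
    ∀ j < D, ((insertList arr D r v).run st).arr (arr (j + 1)) (st.reg r) =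
      st.arr (arr j) (st.reg r) := by
  obtain ⟨h1, h2, h3⟩ := run_shiftList arr harr r D st
  refine ⟨h1, fun m hm => ?_, fun j i hi => ?_, ?_, fun j hj => ?_⟩ <;>
    simp only [insertList, run, Expr.eval, h1]
  · rw [State.setArr_arr_of_ne _ _ _ (hm 0), h2 m hm]
  · rw [State.setArr_arr, if_neg (by simp [hi]), h3, if_neg (by simp [hi])]
  · simp [State.setArr_arr]
  · rw [State.setArr_arr, if_neg (by simp [harr.eq_iff]), h3, if_pos (by omega)]
    rfl

/-- The list at index `i` contains the elements of `S` in its first `S.card` places. -/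
def Lists {n : ℕ} (arr : ℕ → ℕ) (st : State) (i : ℕ) (S : Finset (Fin n)) : Prop :=
  ∀ v ∈ S, ∃ j < S.card, st.arr (arr j) i = (v : ℕ)

theorem Lists.insertList {n : ℕ} {arr : ℕ → ℕ} (harr : Function.Injective arr) {D r v : ℕ}
    {st : State} {S : Finset (Fin n)} (h : Lists arr st (st.reg r) S) (x : Fin n)
    (hx : st.reg v = x) (hxS : x ∉ S) (hD : S.card ≤ D) :
    Lists arr ((SmallSetFlip.insertList arr D r v).run st) (st.reg r) (insert x S) := by
  obtain ⟨-, -, -, h4, h5⟩ := run_insertList arr harr D r v st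
  intro y hy
  rw [Finset.card_insert_of_notMem hxS]
  rcases Finset.mem_insert.1 hy with rfl | hy
  · exact ⟨0, by omega, by rw [h4, hx]⟩
  · obtain ⟨j, hj, he⟩ := h y hy
    exact ⟨j + 1, by omega, by rw [h5 j (by omega), he]⟩

/-- Choosing a place for each element is injective, since the entry recovers the element. With `D`
elements and `D` places it is bijective, so its inverse enumerates `S` without repetition. -/
theorem exists_enumeration {n D : ℕ} (S : Finset (Fin n)) (hS : S.card = D) (f : ℕ → ℕ)
    (h : ∀ v ∈ S, ∃ j < D, f j = (v : ℕ)) :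
    ∃ g : Fin D → Fin n, Function.Injective g ∧ S = Finset.univ.image g ∧
      ∀ j : Fin D, f j = (g j : ℕ) := by
  have h' : ∀ v : S, ∃ j : Fin D, f j = (v.1 : ℕ) := fun v => by
    obtain ⟨j, hj, he⟩ := h v.1 v.2
    exact ⟨⟨j, hj⟩, he⟩
  choose φ hφ using h'
  have hinj : Function.Injective φ := fun v w hvw => by
    refine Subtype.ext (Fin.ext ?_)
    rw [← hφ v, ← hφ w, hvw]
  have hbij : Function.Bijective φ :=
    (Fintype.bijective_iff_injective_and_card φ).2 ⟨hinj, by simp [hS]⟩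
  let e := Equiv.ofBijective φ hbij
  refine ⟨fun j => (e.symm j).1, Subtype.val_injective.comp e.symm.injective, ?_, fun j => ?_⟩
  · ext v
    simp only [Finset.mem_image, Finset.mem_univ, true_and]
    exact ⟨fun hv => ⟨e ⟨v, hv⟩, by simp⟩, by rintro ⟨j, rfl⟩; exact (e.symm j).2⟩
  · rw [← hφ, show φ (e.symm j) = j from e.apply_symm_apply j]

theorem bitArray_apply {m n : ℕ} (v : Fin m × Fin n → ZMod 2) (i : Fin m) (j : Fin n) :
    bitArray v (i * n + j) = (v (i, j)).val := by
  have h : (i : ℕ) * n + j = (finProdFinEquiv (i, j) : ℕ) := by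
    rw [finProdFinEquiv_apply_val]; ring
  rw [h, bitArray, dif_pos (Fin.is_lt _), Fin.eta, Equiv.symm_apply_apply]

theorem nbrA_injective : Function.Injective nbrA := fun i j h => by
  unfold nbrA at h; omega

theorem nbrB_injective : Function.Injective nbrB := fun i j h => by
  unfold nbrB at h; omega

theorem nbrA_ne_nbrB (i j : ℕ) : nbrA i ≠ nbrB j := by
  unfold nbrA nbrB; omega

/-- The machine cannot multiply, so row offsets are tabulated by repeated addition. The 14 is the
cost of the body: two stores at 3 and two additions at 4. -/
theorem buildMultiples_runs (nA nB : ℕ) (st : State) (h0 : st.reg 0 = nA) (h1 : st.reg 1 = nB)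
    (h4 : st.reg 4 = 0) (h5 : st.reg 5 = 0) :
    buildMultiples.Runs st (nA * (14 + 8) + 6) fun st' => st'.reg 0 = nA ∧ st'.reg 1 = nB ∧
      (∀ m, m ≠ 7 → m ≠ 8 → st'.arr m = st.arr m) ∧ (∀ i < nA, st'.arr 7 i = i * nA) ∧
      ∀ i < nA, st'.arr 8 i = i * nB := by
  refine (Runs.forLoop (by decide) nA (fun k st' => st'.reg 1 = nB ∧ st'.reg 4 = k * nA ∧
    st'.reg 5 = k * nB ∧ (∀ m, m ≠ 7 → m ≠ 8 → st'.arr m = st.arr m) ∧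
    (∀ i < k, st'.arr 7 i = i * nA) ∧ ∀ i < k, st'.arr 8 i = i * nB) ?_ ?_ st ?_ h0).mono le_rfl ?_
  · rintro k s v ⟨a1, a2, a3, a4, a5, a6⟩
    exact ⟨by simpa using a1, by simpa using a2, by simpa using a3, a4, a5, a6⟩
  · rintro k hk s ⟨a1, a2, a3, a4, a5, a6⟩ r2 r0
    refine LoopFree.runs_of (p := storeMultiples) ⟨trivial, trivial, trivial, trivial⟩
      ⟨⟨?_, ?_, ?_, ?_, ?_, ?_⟩, ?_, ?_⟩
    · simp [storeMultiples, run, a1]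
    · simp [storeMultiples, run, a2, r0]; ring
    · simp [storeMultiples, run, a3, a1]; ring
    · intro m h7 h8
      simp only [storeMultiples, run, State.setReg_arr]
      rw [State.setArr_arr_of_ne _ _ _ h8, State.setArr_arr_of_ne _ _ _ h7, a4 m h7 h8]
    · intro i hi
      by_cases hik : i = k
      · simp [storeMultiples, run, State.setArr_arr, hik, r2, a2]
      · simp [storeMultiples, run, State.setArr_arr, hik, r2, a5 i (by omega)]
    · intro i hi
      by_cases hik : i = k
      · simp [storeMultiples, run, State.setArr_arr, hik, r2, a3]
      · simp [storeMultiples, run, State.setArr_arr, hik, r2, a6 i (by omega)]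
    · simp [storeMultiples, run, r2]
    · simp [storeMultiples, run, r0]
  · exact ⟨h1, by simp [h4], by simp [h5], fun _ _ _ => rfl, by simp, by simp⟩
  · rintro s ⟨⟨a1, a2, a3, a4, a5, a6⟩, r0⟩
    exact ⟨r0, a1, a4, a5, a6⟩

section

variable {nA nB ΔA ΔB : ℕ} {G : BipartiteGraph nA nB}

/-- The pair `(b, a)` is scanned before the pair `(k, l)`. -/
def Scanned (k l b a : ℕ) : Prop := b < k ∨ b = k ∧ a < l

instance (k l b a : ℕ) : Decidable (Scanned k l b a) := by unfold Scanned; infer_instance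

/-- The neighbours of a left vertex that have been found before the pair `(k, l)`. -/
noncomputable def foundA (G : BipartiteGraph nA nB) (k l : ℕ) (a : Fin nA) : Finset (Fin nB) :=
  (G.nl a).filter fun b => Scanned k l b a

/-- The neighbours of a right vertex that have been found before the pair `(k, l)`. -/
noncomputable def foundB (G : BipartiteGraph nA nB) (k l : ℕ) (b : Fin nB) : Finset (Fin nA) :=
  (G.nr b).filter fun a => Scanned k l b a

theorem mem_foundA {k l : ℕ} {a : Fin nA} {b : Fin nB} :
    b ∈ foundA G k l a ↔ G.Adj a b ∧ Scanned k l b a := by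
  rw [foundA, Finset.mem_filter, mem_nl]

theorem mem_foundB {k l : ℕ} {a : Fin nA} {b : Fin nB} :
    a ∈ foundB G k l b ↔ G.Adj a b ∧ Scanned k l b a := by
  rw [foundB, Finset.mem_filter, mem_nr]

theorem scanned_succ (a₀ a : Fin nA) (b₀ b : Fin nB) :
    Scanned b₀ (a₀ + 1) b a ↔ (a = a₀ ∧ b = b₀) ∨ Scanned b₀ a₀ b a := by
  simp only [Scanned, Fin.ext_iff]
  omega

theorem found_succ (a₀ : Fin nA) (b₀ : Fin nB) (h : G.Adj a₀ b₀) :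
    (∀ a, foundA G b₀ (a₀ + 1) a =
      if a = a₀ then insert b₀ (foundA G b₀ a₀ a) else foundA G b₀ a₀ a) ∧
    ∀ b, foundB G b₀ (a₀ + 1) b =
      if b = b₀ then insert a₀ (foundB G b₀ a₀ b) else foundB G b₀ a₀ b := by
  constructor
  · intro a
    ext b
    split_ifs with ha
    · subst ha
      by_cases hb : b = b₀
      · subst hb; simp [mem_foundA, scanned_succ, h]
      · simp [mem_foundA, scanned_succ, hb]
    · simp [mem_foundA, scanned_succ, ha]
  · intro b
    ext a
    split_ifs with hb
    · subst hb
      by_cases ha : a = a₀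
      · subst ha; simp [mem_foundB, scanned_succ, h]
      · simp [mem_foundB, scanned_succ, ha]
    · simp [mem_foundB, scanned_succ, hb]

theorem found_succ_of_not_adj (a₀ : Fin nA) (b₀ : Fin nB) (h : ¬ G.Adj a₀ b₀) :
    (∀ a, foundA G b₀ (a₀ + 1) a = foundA G b₀ a₀ a) ∧
    ∀ b, foundB G b₀ (a₀ + 1) b = foundB G b₀ a₀ b := by
  have key : ∀ (a : Fin nA) (b : Fin nB), G.Adj a b →
      (Scanned b₀ (a₀ + 1) b a ↔ Scanned b₀ a₀ b a) := by
    intro a b hab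
    rw [scanned_succ, or_iff_right]
    rintro ⟨rfl, rfl⟩
    exact h hab
  exact ⟨fun a => Finset.filter_congr fun b hb => key a b (mem_nl.1 hb),
    fun b => Finset.filter_congr fun a ha => key a b (mem_nr.1 ha)⟩

theorem scan_runs (hG : G.IsBiregular ΔA ΔB) (hn : nB ≤ nA) (st : State) (h0 : st.reg 0 = nA)
    (h1 : st.reg 1 = nB) (hmul : ∀ i < nA, st.arr 7 i = i * nA)
    (hH : st.arr 0 = bitArray fun p => G.H p.1 p.2) :
    (forLoop₂ (scanPair ΔA ΔB)).Runs st
      (nB * (nA * ((scanPair ΔA ΔB).timeBound + 8) + 6 + 8) + 6) fun st' =>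
        st'.reg 0 = nA ∧ st'.reg 1 = nB ∧ (∀ m < 11, st'.arr m = st.arr m) ∧
        (∀ a : Fin nA, Lists nbrA st' a (G.nl a)) ∧ ∀ b : Fin nB, Lists nbrB st' b (G.nr b) := by
  refine (Runs.forLoop₂ nA nB (fun k l st' => (∀ m < 11, st'.arr m = st.arr m) ∧
    (∀ a : Fin nA, Lists nbrA st' a (foundA G k l a)) ∧
    ∀ b : Fin nB, Lists nbrB st' b (foundB G k l b)) (fun _ _ _ _ h => h) (fun _ _ _ _ h => h)
    ?_ ?_ st ?_ h0 h1).mono le_rfl ?_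
  · rintro k s ⟨a1, a2, a3⟩
    have key : ∀ b a, a < nA → (Scanned (k + 1) 0 b a ↔ Scanned k nA b a) := by
      intro b a ha; unfold Scanned; omega
    refine ⟨a1, fun a => ?_, fun b => ?_⟩
    · have : foundA G (k + 1) 0 a = foundA G k nA a :=
        Finset.filter_congr fun b _ => key b a a.2
      rw [this]; exact a2 a
    · have : foundB G (k + 1) 0 b = foundB G k nA b :=
        Finset.filter_congr fun a _ => key b a a.2
      rw [this]; exact a3 b
  · rintro k hk l hl s ⟨a1, a2, a3⟩ r0 r1 r2 r3
    refine (loopFree_scanPair ΔA ΔB).runs_of ?_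
    obtain ⟨a₀, rfl⟩ : ∃ a₀ : Fin nA, (a₀ : ℕ) = l := ⟨⟨l, hl⟩, rfl⟩
    obtain ⟨b₀, rfl⟩ : ∃ b₀ : Fin nB, (b₀ : ℕ) = k := ⟨⟨k, hk⟩, rfl⟩
    have hbit : (Expr.get 0 (.add (.get 7 (.reg 2)) (.reg 3))).eval s = (G.H b₀ a₀).val := by
      simp only [Expr.eval, r2, r3]
      rw [a1 7 (by decide), a1 0 (by decide), hmul _ (b₀.2.trans_le hn), hH,
        bitArray_apply (fun p => G.H p.1 p.2) b₀ a₀]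
    by_cases hadj : G.Adj a₀ b₀
    · have hrun : (scanPair ΔA ΔB).run s =
          (insertList nbrB ΔB 2 3).run ((insertList nbrA ΔA 3 2).run s) := by
        rw [scanPair, run, hbit, if_neg (by simp [H, hadj])]
        rfl
      rw [hrun]
      obtain ⟨p1, p2, p3, -, -⟩ := run_insertList nbrA nbrA_injective ΔA 3 2 s
      set s₁ := (insertList nbrA ΔA 3 2).run s with hs₁
      obtain ⟨q1, q2, q3, -, -⟩ := run_insertList nbrB nbrB_injective ΔB 2 3 s₁
      set s₂ := (insertList nbrB ΔB 2 3).run s₁ with hs₂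
      have eA : ∀ j, s₂.arr (nbrA j) = s₁.arr (nbrA j) := fun j => q2 _ fun i => nbrA_ne_nbrB j i
      have eB : ∀ j, s₁.arr (nbrB j) = s.arr (nbrB j) :=
        fun j => p2 _ fun i => (nbrA_ne_nbrB i j).symm
      obtain ⟨f1, f2⟩ := found_succ a₀ b₀ hadj
      refine ⟨⟨fun m hm => ?_, fun a => ?_, fun b => ?_⟩, ?_⟩
      · rw [q2 m (fun j => by unfold nbrB; omega), p2 m (fun j => by unfold nbrA; omega), a1 m hm]
      · rw [f1]
        split_ifs with ha
        · subst ha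
          have hl : Lists nbrA s (s.reg 3) (foundA G b₀ a a) := by rw [r3]; exact a2 a
          -- The pair has not been scanned before, so `b₀` is new. The list never outgrows the
          -- degree, so the shift loses nothing.
          have := hl.insertList nbrA_injective (D := ΔA) (v := 2) b₀ r2
            (by simp [foundA, Scanned])
            ((Finset.card_filter_le _ _).trans (hG.1 a).le)
          rw [r3] at this
          intro v hv
          obtain ⟨j, hj, he⟩ := this v hv
          exact ⟨j, hj, by rw [eA]; exact he⟩
        · intro v hv
          obtain ⟨j, hj, he⟩ := a2 a v hv
          refine ⟨j, hj, ?_⟩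
          rw [eA, p3 _ _ (by rw [r3]; exact fun h => ha (Fin.ext h)), he]
      · rw [f2]
        split_ifs with hb
        · subst hb
          have hl : Lists nbrB s₁ (s₁.reg 2) (foundB G b a₀ b) := by
            rw [p1, r2]
            intro v hv
            obtain ⟨j, hj, he⟩ := a3 b v hv
            exact ⟨j, hj, by rw [eB]; exact he⟩
          have := hl.insertList nbrB_injective (D := ΔB) (v := 3) a₀ (by rw [p1, r3])
            (by simp [foundB, Scanned])
            ((Finset.card_filter_le _ _).trans (hG.2 b).le)
          rw [p1, r2] at this
          exact this
        · intro v hv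
          obtain ⟨j, hj, he⟩ := a3 b v hv
          refine ⟨j, hj, ?_⟩
          rw [q3 _ _ (by rw [p1, r2]; exact fun h => hb (Fin.ext h)), eB, he]
      · rw [q1, p1]; exact ⟨r0, r1, r2, r3⟩
    · have hrun : (scanPair ΔA ΔB).run s = s := by
        rw [scanPair, run, hbit, if_pos (by simp [H, hadj])]
        rfl
      obtain ⟨f1, f2⟩ := found_succ_of_not_adj a₀ b₀ hadj
      rw [hrun]
      exact ⟨⟨a1, fun a => by rw [f1]; exact a2 a, fun b => by rw [f2]; exact a3 b⟩, r0, r1, r2, r3⟩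
  · refine ⟨fun _ _ => rfl, fun a v hv => ?_, fun b v hv => ?_⟩
    · simp [foundA, Scanned] at hv
    · simp [foundB, Scanned] at hv
  · rintro s ⟨⟨a1, a2, a3⟩, r0, r1⟩
    refine ⟨r0, r1, a1, fun a => ?_, fun b => ?_⟩
    · have : foundA G nB 0 a = G.nl a :=
        Finset.filter_true_of_mem fun b _ => .inl b.2
      rw [← this]; exact a2 a
    · have : foundB G nB 0 b = G.nr b :=
        Finset.filter_true_of_mem fun a _ => .inl b.2
      rw [← this]; exact a3 b

theorem exists_tables (hG : G.IsBiregular ΔA ΔB) (st : State)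
    (hA : ∀ i < nA, st.arr 7 i = i * nA) (hB : ∀ i < nA, st.arr 8 i = i * nB)
    (hlA : ∀ a : Fin nA, Lists nbrA st a (G.nl a)) (hlB : ∀ b : Fin nB, Lists nbrB st b (G.nr b)) :
    ∃ (ν : Fin nA → Fin ΔA → Fin nB) (μ : Fin nB → Fin ΔB → Fin nA),
      Enumerates G ν μ ∧ Tables ν μ st := by
  have h1 : ∀ a : Fin nA, (G.nl a).card = ΔA := hG.1
  have h2 : ∀ b : Fin nB, (G.nr b).card = ΔB := hG.2
  choose ν ν1 ν2 ν3 using fun a : Fin nA => exists_enumeration (G.nl a) (h1 a)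
    (fun j => st.arr (nbrA j) a) fun v hv => by simpa [h1] using hlA a v hv
  choose μ μ1 μ2 μ3 using fun b : Fin nB => exists_enumeration (G.nr b) (h2 b)
    (fun j => st.arr (nbrB j) b) fun v hv => by simpa [h2] using hlB b v hv
  exact ⟨ν, μ, ⟨ν1, μ1, ν2, μ2⟩, ⟨hA, hB, ν3, μ3⟩⟩

end

/-! ### Total running time and correctness -/

/-- A bound for the running time of one phase. -/
noncomputable def phaseTime (z : Bool) (ΔA ΔB nA nB : ℕ) : ℕ :=
  2 + ((nB * (nA * ((push (.reg 2) (.reg 3)).timeBound + 8) + 6 + 8) + 6) +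
    (((ΔB * ΔA) * (ΔA * ΔB) * (nA * nB) + nB * nA) * (2 + (round z ΔA ΔB).timeBound) + 2))

theorem nested_time_le {nA nB N : ℕ} (T : ℕ) (h : nA * nB ≤ N) (hB : nB ≤ N) (h1 : 1 ≤ N) :
    nB * (nA * (T + 8) + 6 + 8) + 6 ≤ (T + 28) * N := by
  have := Nat.mul_le_mul_left (T + 8) h
  nlinarith

theorem phaseTime_le (z : Bool) (ΔA ΔB : ℕ) {nA nB N : ℕ} (h : nA * nB ≤ N) (hB : nB ≤ N)
    (h1 : 1 ≤ N) : phaseTime z ΔA ΔB nA nB ≤ ((push (.reg 2) (.reg 3)).timeBound + 32 +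
      ((ΔB * ΔA) * (ΔA * ΔB) + 1) * (2 + (round z ΔA ΔB).timeBound)) * N := by
  have e1 := nested_time_le (push (.reg 2) (.reg 3)).timeBound h hB h1
  have e2 : ((ΔB * ΔA) * (ΔA * ΔB) * (nA * nB) + nB * nA) * (2 + (round z ΔA ΔB).timeBound) ≤
      ((ΔB * ΔA) * (ΔA * ΔB) + 1) * (2 + (round z ΔA ΔB).timeBound) * N := by
    calc _ = ((ΔB * ΔA) * (ΔA * ΔB) + 1) * (2 + (round z ΔA ΔB).timeBound) * (nA * nB) := by ring
      _ ≤ _ := Nat.mul_le_mul_left _ h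
  unfold phaseTime
  linarith

end SmallSetFlip

-- The second phase reads and writes transposed tables, so it too decodes with respect to `H_X`, for
-- the swapped syndrome. The phases do not disturb each other: one works on arrays `1`, `3`, `4`,
-- the other on `2`, `5`, `6`, and only the stack is reused.
open SmallSetFlip RAM Program BipartiteGraph in
theorem SmallSetFlip.decoder_runs {nA nB ΔA ΔB : ℕ} {G : BipartiteGraph nA nB} (hΔA : 0 < ΔA)
    (hΔB : 0 < ΔB) (hn : nB ≤ nA) (hG : G.IsBiregular ΔA ΔB) (sX : Fin nA × Fin nB → ZMod 2)
    (sZ : Fin nB × Fin nA → ZMod 2) :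
    (decoder ΔA ΔB).Runs (decoderInput G sX sZ)
      ((nA * (14 + 8) + 6) + ((nB * (nA * ((scanPair ΔA ΔB).timeBound + 8) + 6 + 8) + 6) +
        (phaseTime false ΔA ΔB nA nB + phaseTime true ΔA ΔB nA nB))) fun st =>
      ∃ oX oZ : Qubit nA nB → ZMod 2, DecoderOutputs st oX (oZ ∘ swapQubit) ∧
        (3 * hammingNorm (sX + G.HX.mulVec oX) + hammingNorm oX ≤ 3 * hammingNorm sX ∧
          ∀ β α, Stuck G (sX + G.HX.mulVec oX) β α) ∧
        (3 * hammingNorm (sZ ∘ Prod.swap + G.HX.mulVec oZ) + hammingNorm oZ ≤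
            3 * hammingNorm (sZ ∘ Prod.swap) ∧
          ∀ β α, Stuck G (sZ ∘ Prod.swap + G.HX.mulVec oZ) β α) := by
  refine (buildMultiples_runs nA nB _ rfl rfl rfl rfl).seq ?_
  rintro st₁ ⟨a0, a1, a2, a3, a4⟩
  refine (scan_runs hG hn st₁ a0 a1 a3 (a2 0 (by decide) (by decide))).seq ?_
  rintro st₂ ⟨b0, b1, b2, b3, b4⟩
  obtain ⟨ν, μ, he, ht⟩ := exists_tables hG st₂ (by rw [b2 7 (by decide)]; exact a3)
    (by rw [b2 8 (by decide)]; exact a4) b3 b4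
  have c : ∀ m < 7, st₂.arr m = (decoderInput G sX sZ).arr m := fun m hm => by
    rw [b2 m (by omega), a2 m (by omega) (by omega)]
  have hX : Rep false st₂ st₂ sX (0 : Qubit nA nB → ZMod 2) :=
    { frame := fun _ _ _ _ _ _ => rfl
      reg_zero := b0
      reg_one := b1
      syn := fun a b => by
        rw [synArr, c 1 (by decide)]; exact bitArray_apply sX a b
      outA := fun a α => by rw [outArrA, c 3 (by decide)]; rfl
      outB := fun β b => by rw [outArrB, c 4 (by decide)]; rfl }
  refine (phase_runs hΔA hΔB he ht hn hX).seq ?_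
  rintro st₃ ⟨s, oX, d1, rfl, d3, d4⟩
  have f : ∀ m < 7, m ≠ 1 → m ≠ 3 → m ≠ 4 → st₃.arr m = (decoderInput G sX sZ).arr m :=
    fun m hm h1 h3 h4 => by rw [d1.frame m h1 h3 h4 (by omega) (by omega), c m hm]
  have hZ : Rep true st₃ st₃ (sZ ∘ Prod.swap) (0 : Qubit nA nB → ZMod 2) :=
    { frame := fun _ _ _ _ _ _ => rfl
      reg_zero := d1.reg_zero
      reg_one := d1.reg_one
      syn := fun a b => by
        rw [synArr, f 2 (by decide) (by decide) (by decide) (by decide)]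
        exact bitArray_apply sZ b a
      outA := fun a α => by
        rw [outArrA, f 5 (by decide) (by decide) (by decide) (by decide)]; rfl
      outB := fun β b => by
        rw [outArrB, f 6 (by decide) (by decide) (by decide) (by decide)]; rfl }
  refine (phase_runs hΔA hΔB he (d1.tables ht) hn hZ).mono le_rfl ?_
  rintro st₄ ⟨s, oZ, g1, rfl, g3, g4⟩
  refine ⟨oX, oZ, ⟨fun i j => ?_, fun i j => ?_, fun i j => ?_, fun i j => ?_⟩, ⟨d3, d4⟩, ⟨g3, g4⟩⟩
  · rw [g1.frame 3 (by decide) (by decide) (by decide) (by decide) (by decide)]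
    exact d1.outA i j
  · rw [g1.frame 4 (by decide) (by decide) (by decide) (by decide) (by decide)]
    exact d1.outB i j
  · exact g1.outA j i
  · exact g1.outB j i

open SmallSetFlip BipartiteGraph in
theorem theorem2 (ΔA ΔB : ℕ) (hΔA : 0 < ΔA) (hΔB : 0 < ΔB) :
    ∃ (P : RAM.Program) (C : ℕ),
      ∀ (nA nB : ℕ) (G : BipartiteGraph nA nB) (γA δA γB δB : ℝ),
        0 < nA → 0 < nB → nB ≤ nA →
        G.IsBiregular ΔA ΔB →
        0 < γA → 0 < δA → 0 < γB → 0 < δB →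
        G.IsLeftExpanding ΔA γA δA → G.IsRightExpanding ΔB γB δB →
        δA < 1 / 6 → δB < 1 / 6 →
        ∀ (sX : Fin nA × Fin nB → ZMod 2) (sZ : Fin nB × Fin nA → ZMod 2),
          ∃ (t : ℕ) (s : RAM.State),
            RAM.Exec P (decoderInput G sX sZ) t s ∧
            t ≤ C * (nA ^ 2 + nB ^ 2) ∧
            ∀ eX eZ : Qubit nA nB → ZMod 2,
              G.HX.mulVec eX = sX → G.HZ.mulVec eZ = sZ →
              (errorWeight eX eZ : ℝ) < 1 / (3 * (1 + (ΔB : ℝ))) * min (γA * nA) (γB * nB) →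
              CorrectlyDecodes G s eX eZ := by
  refine ⟨decoder ΔA ΔB, 28 + ((scanPair ΔA ΔB).timeBound + 28 +
    (((push (.reg 2) (.reg 3)).timeBound + 32 +
      ((ΔB * ΔA) * (ΔA * ΔB) + 1) * (2 + (round false ΔA ΔB).timeBound)) +
    ((push (.reg 2) (.reg 3)).timeBound + 32 +
      ((ΔB * ΔA) * (ΔA * ΔB) + 1) * (2 + (round true ΔA ΔB).timeBound)))), ?_⟩
  intro nA nB G γA δA γB δB hnA hnB hn hG _ _ _ _ hlA hrB hδA hδB sX sZ
  obtain ⟨t, s, hexec, hT, oX, oZ, hout, ⟨hX, hXs⟩, ⟨hZ, hZs⟩⟩ :=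
    decoder_runs hΔA hΔB hn hG sX sZ
  refine ⟨t, s, hexec, hT.trans ?_, ?_⟩
  · have h1 : 1 ≤ nA ^ 2 + nB ^ 2 := by nlinarith
    have h2 : nA * nB ≤ nA ^ 2 + nB ^ 2 := by nlinarith
    have h3 : nB ≤ nA ^ 2 + nB ^ 2 := by nlinarith
    have h4 : nA ≤ nA ^ 2 + nB ^ 2 := by nlinarith
    have e1 := nested_time_le (scanPair ΔA ΔB).timeBound h2 h3 h1
    have e2 := phaseTime_le false ΔA ΔB h2 h3 h1
    have e3 := phaseTime_le true ΔA ΔB h2 h3 h1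
    linarith
  · intro eX eZ hsX hsZ hw
    have hcoef : (0 : ℝ) < 3 * (1 + (ΔB : ℝ)) := by positivity
    have hwX : hammingNorm eX ≤ errorWeight eX eZ :=
      Finset.card_le_card (Finset.monotone_filter_right _ fun q _ h => Or.inl h)
    have hwZ : hammingNorm eZ ≤ errorWeight eX eZ :=
      Finset.card_le_card (Finset.monotone_filter_right _ fun q _ h => Or.inr h)
    have hmX : eX + oX ∈ rowSpace G.HZ := by
      refine add_mem_rowSpace_of_stuck hΔA hΔB hnA hn hG hlA hrB hδA hδB eX oX
        (lt_of_le_of_lt (by exact_mod_cast hwX) hw) ?_ ?_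
      · rw [Matrix.mulVec_add, hsX]; exact hX
      · intro β α x y hx hy
        rw [Matrix.mulVec_add, hsX]; exact hXs β α x y hx hy
    have hsZ' : G.HX.mulVec (eZ ∘ swapQubit) = sZ ∘ Prod.swap := by
      rw [HX_mulVec_comp_swapQubit, hsZ]
    have hmZ : eZ ∘ swapQubit + oZ ∈ rowSpace G.HZ := by
      refine add_mem_rowSpace_of_stuck hΔA hΔB hnA hn hG hlA hrB hδA hδB _ oZ
        (lt_of_le_of_lt ?_ hw) ?_ ?_
      · rw [hammingNorm_comp_swapQubit]; exact_mod_cast hwZ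
      · rw [Matrix.mulVec_add, hsZ']; exact hZ
      · intro β α x y hx hy
        rw [Matrix.mulVec_add, hsZ']; exact hZs β α x y hx hy
    -- The output `o` equals `e + (e + o)`, so the required row-space element is `e + o`, up to the
    -- swap in the second component.
    refine ⟨eX + oX, hmX, (eZ ∘ swapQubit + oZ) ∘ swapQubit, comp_swapQubit_mem_rowSpace hmZ, ?_⟩
    have e1 : eX + (eX + oX) = oX := by
      rw [← add_assoc, add_self_eq_zero_of_zmod, zero_add]
    have e2 : eZ + (eZ ∘ swapQubit + oZ) ∘ swapQubit = oZ ∘ swapQubit := by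
      have : (eZ ∘ swapQubit + oZ) ∘ swapQubit = eZ + oZ ∘ swapQubit := by
        funext q
        simp [swapQubit_swapQubit]
      rw [this, ← add_assoc, add_self_eq_zero_of_zmod, zero_add]
    rw [e1, e2]
    exact hout
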